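/- Let $m\ge 2$, and let $\mathcal T$ be the $m$-adic rooted tree, whose vertices are the finite words in the letters $1,\dots,m$. Let $\Gamma_m\le \mathrm{Aut}\,\mathcal T$ be the group of all automorphisms of $\mathcal T$ whose local actions at all vertices are powers of the cycle $\sigma=(1\,2\cdots m)\in\mathrm{Sym}(m)$, and for $n\ge 0$ let $\mathrm{St}_{\Gamma_m}(n)$ be the subgroup of the elements of $\Gamma_m$ that fix every vertex of level $n$ (every word of length $n$). For $G\le\Gamma_m$ put $\mathrm{St}_G(n)=\mathrm{St}_{\Gamma_m}(n)\cap G$. Endow $\Gamma_m$ with the metric $$d(g,h)=\inf\{|\Gamma_m:\mathrm{St}_{\Gamma_m}(n)|^{-1} : n\ge 0,\ gh^{-1}\in \mathrm{St}_{\Gamma_m}(n)\},$$ and let $\mathrm{hdim}_{\Gamma_m}$ denote the Hausdorff dimension with respect to $d$. Let $H=\langle a,b\rangle\le\Gamma_m$ be the generalized Brunner–Sidki–Vieira group, where $a$ and $b$ are the automorphisms defined recursively by $\psi(a)=(1,\dots,1,a)\sigma$ and $\psi(b)=(1,\dots,1,b^{-1})\sigma$; that is, for every word $u$, $a$ and $b$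 send $xu$ to $(x+1)u$ for each letter $x<m$, while $a$ sends $mu$ to $1a(u)$ and $b$ sends $mu$ to $1b^{-1}(u)$. Then the Hausdorff dimension of the closure $\overline H$ of $H$ in $\Gamma_m$, which is also given by the lower limit below, is $$\mathrm{hdim}_{\Gamma_m}(\overline{H})=\liminf_{n\to\infty}\frac{\log_m|H:\mathrm{St}_H(n)|}{\log_m|\Gamma_m:\mathrm{St}_{\Gamma_m}(n)|}=\frac{m-\tau(m-1)\log_m 2}{m+1},$$ where $\tau=0$ if $m$ is odd and $\tau=1$ if $m$ is even. -/

import Mathlib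

open Filter Topology
open scoped ENNReal

namespace MAdicTree

/-- The `m`-adic rooted tree: vertices are the finite words in `m` letters (the root is the empty
word), and two vertices are adjacent if one is obtained from the other by appending a letter.
The letters `1, …, m` are `0, …, m - 1` here. -/
def tree (m : ℕ) : SimpleGraph (List (Fin m)) where
  Adj u v := (∃ x, u = v ++ [x]) ∨ ∃ x, v = u ++ [x]
  symm := ⟨fun _ _ h => h.symm⟩
  loopless := ⟨by rintro u (⟨x, h⟩ | ⟨x, h⟩) <;> simpa using congrArg List.length h⟩

/-- The group of graph automorphisms of the `m`-adic tree. -/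
abbrev AutTree (m : ℕ) : Type := tree m ≃g tree m

/-- Every local action (label) of `g` is a power of the cycle `σ = (1 2 ⋯ m)`. -/
def HasCyclicLabels {m : ℕ} (g : List (Fin m) → List (Fin m)) : Prop :=
  ∀ v, ∃ k : ℤ, ∀ x, g (v ++ [x]) = g v ++ [(finRotate m ^ k) x]

theorem HasCyclicLabels.symm {m : ℕ} {e : Equiv.Perm (List (Fin m))} (h : HasCyclicLabels e) :
    HasCyclicLabels e.symm := by
  intro w
  obtain ⟨k, hk⟩ := h (e.symm w)
  refine ⟨-k, fun x => ?_⟩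
  rw [Equiv.symm_apply_eq, hk]
  have h1 : (finRotate m ^ k) ((finRotate m ^ (-k)) x) = x := by
    rw [← Equiv.Perm.mul_apply, ← zpow_add, add_neg_cancel, zpow_zero, Equiv.Perm.one_apply]
  rw [h1, Equiv.apply_symm_apply]

theorem HasCyclicLabels.adj {m : ℕ} {g : List (Fin m) → List (Fin m)} (h : HasCyclicLabels g)
    {u v : List (Fin m)} (huv : (tree m).Adj u v) : (tree m).Adj (g u) (g v) := by
  rcases huv with ⟨x, rfl⟩ | ⟨x, rfl⟩
  · obtain ⟨k, hk⟩ := h v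
    exact Or.inl ⟨_, hk x⟩
  · obtain ⟨k, hk⟩ := h u
    exact Or.inr ⟨_, hk x⟩

/-- The group `Γ_m` of `m`-adic automorphisms. -/
def Gamma (m : ℕ) : Subgroup (AutTree m) where
  carrier := {g | HasCyclicLabels g}
  one_mem' := fun v => ⟨0, fun x => by simp⟩
  mul_mem' := by
    intro g h hg hh v
    obtain ⟨k, hk⟩ := hh v
    obtain ⟨l, hl⟩ := hg (h v)
    refine ⟨l + k, fun x => ?_⟩
    rw [RelIso.coe_mul, Function.comp_apply, Function.comp_apply, hk, hl, zpow_add,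
      Equiv.Perm.mul_apply]
  inv_mem' := fun {g} hg => HasCyclicLabels.symm (e := g.toEquiv) hg

/-- A permutation of the vertices whose labels are powers of `σ`, as an element of `Γ_m`. -/
def Gamma.ofPerm {m : ℕ} (e : Equiv.Perm (List (Fin m))) (h : HasCyclicLabels e) : Gamma m :=
  ⟨⟨e, fun {u v} => ⟨fun huv => by simpa using h.symm.adj huv, h.adj⟩⟩, h⟩

/-- The action of an element of `Γ_m` on the vertices. -/
def act {m : ℕ} (g : Gamma m) (v : List (Fin m)) : List (Fin m) := (g : AutTree m) v

theorem act_mul {m : ℕ} (g h : Gamma m) (v : List (Fin m)) : act (g * h) v = act g (act h v) := rfl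

theorem act_length {m : ℕ} (g : Gamma m) (v : List (Fin m)) : (act g v).length = v.length := by
  have key : ∀ v, (act g v).length = (act g []).length + v.length := by
    intro v
    induction v using List.reverseRecOn with
    | nil => simp
    | append_singleton v x ih =>
      obtain ⟨k, hk⟩ := g.2 v
      have : act g (v ++ [x]) = act g v ++ [(finRotate m ^ k) x] := hk x
      rw [this]
      simp [ih, add_assoc]
  obtain ⟨w, hw⟩ := (g : AutTree m).surjective []
  have h0 := key w
  have hw' : act g w = [] := hw
  rw [hw'] at h0
  have h1 : ([] : List (Fin m)).length = 0 := rfl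
  have := key v
  omega

/-- The level stabilizer `St(n)` in `Γ_m`: the elements fixing every vertex of level `n`. -/
def levelStabilizer (m n : ℕ) : Subgroup (Gamma m) where
  carrier := {g | ∀ v : List (Fin m), v.length = n → act g v = v}
  one_mem' := fun _ _ => rfl
  mul_mem' := fun {g h} hg hh v hv => by rw [act_mul, hh v hv, hg v hv]
  inv_mem' := fun {g} hg v hv => by
    conv_lhs => rw [← hg v hv]
    rw [← act_mul, inv_mul_cancel]
    rfl

theorem levelStabilizer_antitone (m : ℕ) : Antitone (levelStabilizer m) := by
  refine antitone_nat_of_succ_le fun n g hg v hv => ?_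
  cases v with
  | nil => exact List.length_eq_zero_iff.1 (act_length g [])
  | cons y u =>
    obtain ⟨k, hk⟩ := g.2 (y :: u)
    have h1 : act g ((y :: u) ++ [y]) = act g (y :: u) ++ [(finRotate m ^ k) y] := hk y
    rw [hg _ (by simpa using hv)] at h1
    exact (List.append_inj_left' h1 rfl).symm

instance levelStabilizer_finiteIndex (m n : ℕ) : (levelStabilizer m n).FiniteIndex := by
  have : Finite {v : List (Fin m) // v.length = n} :=
    inferInstanceAs (Finite (List.Vector (Fin m) n))
  let f : Gamma m → ({v : List (Fin m) // v.length = n} → {v : List (Fin m) // v.length = n}) :=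
    fun g v => ⟨act g v, (act_length g v).trans v.2⟩
  have hf : Finite (Gamma m ⧸ levelStabilizer m n) := by
    refine Finite.of_injective (β := {v : List (Fin m) // v.length = n} →
        {v : List (Fin m) // v.length = n}) (fun q => f q.out) fun p q hpq => ?_
    rw [← p.out_eq', ← q.out_eq']
    refine QuotientGroup.eq.2 fun v hv => ?_
    have := congrArg Subtype.val (congrFun hpq ⟨v, hv⟩)
    have h2 : act p.out v = act q.out v := this
    rw [act_mul, ← h2, ← act_mul, inv_mul_cancel]
    rfl
  exact Subgroup.finiteIndex_of_finite_quotient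

open Classical in
/-- The metric of the profinite group `Γ_m` given by the filtration of the level stabilizers:
`d(g, h) = inf {|Γ_m : St(n)|⁻¹ : g h⁻¹ ∈ St(n)}` for `g ≠ h`, and `d(g, g) = 0`. -/
noncomputable def gammaEDist {m : ℕ} (g h : Gamma m) : ℝ≥0∞ :=
  if g = h then 0
  else ⨅ (n : ℕ) (_ : g * h⁻¹ ∈ levelStabilizer m n), ((levelStabilizer m n).index : ℝ≥0∞)⁻¹

theorem gammaEDist_triangle {m : ℕ} (g h k : Gamma m) :
    gammaEDist g k ≤ gammaEDist g h + gammaEDist h k := by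
  by_cases hgh : g = h
  · simp [hgh]
  by_cases hhk : h = k
  · simp [hhk]
  by_cases hgk : g = k
  · simp [gammaEDist, hgk]
  refine le_trans ?_ (max_le_add_of_nonneg (zero_le) (zero_le))
  simp only [gammaEDist, if_neg hgh, if_neg hhk, if_neg hgk]
  by_contra! hlt
  obtain ⟨h1, h2⟩ := max_lt_iff.1 hlt
  simp only [iInf_lt_iff] at h1 h2
  obtain ⟨n, hn, h1⟩ := h1
  obtain ⟨l, hl, h2⟩ := h2
  have hmem : ∀ j, j ≤ n → j ≤ l → g * k⁻¹ ∈ levelStabilizer m j := by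
    intro j hjn hjl
    have := mul_mem (levelStabilizer_antitone m hjn hn) (levelStabilizer_antitone m hjl hl)
    simpa [mul_assoc] using this
  rcases le_total n l with hle | hle
  · exact absurd h1 (not_lt.2 (iInf₂_le n (hmem n le_rfl hle)))
  · exact absurd h2 (not_lt.2 (iInf₂_le l (hmem l hle le_rfl)))

noncomputable instance (m : ℕ) : EMetricSpace (Gamma m) where
  edist := gammaEDist
  edist_self g := by simp [gammaEDist]
  edist_comm g h := by
    have : ∀ n, g * h⁻¹ ∈ levelStabilizer m n ↔ h * g⁻¹ ∈ levelStabilizer m n := fun n => by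
      rw [← inv_mem_iff]; simp
    by_cases hgh : g = h
    · rw [hgh]
    · simp only [gammaEDist, this, if_neg hgh, if_neg (Ne.symm hgh)]
  edist_triangle := gammaEDist_triangle
  eq_of_edist_eq_zero := by
    intro g h h0
    by_contra hne
    have hex : ∃ v, act (g * h⁻¹) v ≠ v := by
      by_contra! hall
      refine hne (mul_inv_eq_one.1 (Subtype.ext (RelIso.ext fun v => ?_)))
      exact hall v
    obtain ⟨v, hv⟩ := hex
    have hge : ((levelStabilizer m v.length).index : ℝ≥0∞)⁻¹ ≤ gammaEDist g h := by
      rw [gammaEDist, if_neg hne]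
      refine le_iInf₂ fun n hn => ENNReal.inv_le_inv.2 (Nat.cast_le.2 ?_)
      refine Subgroup.index_antitone (levelStabilizer_antitone m ?_)
      by_contra! hlt
      exact hv (levelStabilizer_antitone m hlt.le hn v rfl)
    have h0' : gammaEDist g h = 0 := h0
    rw [h0', nonpos_iff_eq_zero, ENNReal.inv_eq_zero] at hge
    exact ENNReal.natCast_ne_top _ hge

/-- The automorphism `a` with `ψ(a) = (1, …, 1, a)σ`: it sends the word `xu` to `σ(x)u` if the
letter `x` is not the last one, and to `σ(x)a(u)` if it is. -/
def aFun {m : ℕ} : List (Fin m) → List (Fin m)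
  | [] => []
  | x :: u => finRotate m x :: if (x : ℕ) + 1 = m then aFun u else u

/-- The inverse of `a`. -/
def aInvFun {m : ℕ} : List (Fin m) → List (Fin m)
  | [] => []
  | y :: u => (finRotate m).symm y ::
      if ((finRotate m).symm y : ℕ) + 1 = m then aInvFun u else u

mutual

/-- The automorphism `b` with `ψ(b) = (1, …, 1, b⁻¹)σ`. -/
def bFun {m : ℕ} : List (Fin m) → List (Fin m)
  | [] => []
  | x :: u => finRotate m x :: if (x : ℕ) + 1 = m then bInvFun u else u

/-- The inverse of `b`. -/
def bInvFun {m : ℕ} : List (Fin m) → List (Fin m)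
  | [] => []
  | y :: u => (finRotate m).symm y ::
      if ((finRotate m).symm y : ℕ) + 1 = m then bFun u else u

end

theorem aInvFun_aFun {m : ℕ} (v : List (Fin m)) : aInvFun (aFun v) = v := by
  induction v with
  | nil => rfl
  | cons x u ih => by_cases h : (x : ℕ) + 1 = m <;> simp [-finRotate_apply, -finRotate_symm_apply, aFun, aInvFun, h, ih]

theorem aFun_aInvFun {m : ℕ} (v : List (Fin m)) : aFun (aInvFun v) = v := by
  induction v with
  | nil => rfl
  | cons x u ih =>
    by_cases h : ((finRotate m).symm x : ℕ) + 1 = m <;> simp [-finRotate_apply, -finRotate_symm_apply, aFun, aInvFun, h, ih]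

theorem bFun_bInvFun {m : ℕ} (v : List (Fin m)) :
    bInvFun (bFun v) = v ∧ bFun (bInvFun v) = v := by
  induction v with
  | nil => simp [-finRotate_apply, -finRotate_symm_apply, bFun, bInvFun]
  | cons x u ih =>
    constructor
    · by_cases h : (x : ℕ) + 1 = m <;> simp [-finRotate_apply, -finRotate_symm_apply, bFun, bInvFun, h, ih]
    · by_cases h : ((finRotate m).symm x : ℕ) + 1 = m <;> simp [-finRotate_apply, -finRotate_symm_apply, bFun, bInvFun, h, ih]

theorem hasCyclicLabels_aFun {m : ℕ} : HasCyclicLabels (aFun (m := m)) := by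
  intro v
  induction v with
  | nil => exact ⟨1, fun x => by simp [-finRotate_apply, -finRotate_symm_apply, aFun]⟩
  | cons y u ih =>
    by_cases h : (y : ℕ) + 1 = m
    · obtain ⟨k, hk⟩ := ih
      exact ⟨k, fun x => by simp [-finRotate_apply, -finRotate_symm_apply, aFun, h, hk]⟩
    · exact ⟨0, fun x => by simp [-finRotate_apply, -finRotate_symm_apply, aFun, h]⟩

theorem hasCyclicLabels_bFun_bInvFun {m : ℕ} (v : List (Fin m)) :
    (∃ k : ℤ, ∀ x, bFun (v ++ [x]) = bFun v ++ [(finRotate m ^ k) x]) ∧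
      ∃ k : ℤ, ∀ x, bInvFun (v ++ [x]) = bInvFun v ++ [(finRotate m ^ k) x] := by
  induction v with
  | nil =>
    exact ⟨⟨1, fun x => by simp [-finRotate_apply, bFun, bInvFun]⟩,
      ⟨-1, fun x => by simp [-finRotate_apply, -finRotate_symm_apply, bInvFun, bFun, Equiv.Perm.inv_def]⟩⟩
  | cons y u ih =>
    obtain ⟨⟨k, hk⟩, l, hl⟩ := ih
    constructor
    · by_cases h : (y : ℕ) + 1 = m
      · exact ⟨l, fun x => by simp [-finRotate_apply, -finRotate_symm_apply, bFun, h, hl]⟩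
      · exact ⟨0, fun x => by simp [-finRotate_apply, -finRotate_symm_apply, bFun, h]⟩
    · by_cases h : ((finRotate m).symm y : ℕ) + 1 = m
      · exact ⟨k, fun x => by simp [-finRotate_apply, -finRotate_symm_apply, bInvFun, h, hk]⟩
      · exact ⟨0, fun x => by simp [-finRotate_apply, -finRotate_symm_apply, bInvFun, h]⟩

/-- The generator `a` as an element of `Γ_m`. -/
def genA (m : ℕ) : Gamma m :=
  Gamma.ofPerm ⟨aFun, aInvFun, aInvFun_aFun, aFun_aInvFun⟩ hasCyclicLabels_aFun

/-- The generator `b` as an element of `Γ_m`. -/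
def genB (m : ℕ) : Gamma m :=
  Gamma.ofPerm ⟨bFun, bInvFun, fun v => (bFun_bInvFun v).1, fun v => (bFun_bInvFun v).2⟩
    fun v => (hasCyclicLabels_bFun_bInvFun v).1

/-- The generalized Brunner–Sidki–Vieira group `H = ⟨a, b⟩ ≤ Γ_m`. -/
def bsvGroup (m : ℕ) : Subgroup (Gamma m) := Subgroup.closure {genA m, genB m}

/-- The ratio `log_m |G : St_G(n)| / log_m |Γ_m : St(n)|`, for a subgroup `G` of `Γ_m`. -/
noncomputable def logIndexRatio {m : ℕ} (G : Subgroup (Gamma m)) (n : ℕ) : ℝ :=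
  Real.logb m ((levelStabilizer m n).subgroupOf G).index /
    Real.logb m (levelStabilizer m n).index

/-- `τ = 0` for `m` odd and `τ = 1` for `m` even. -/
def tau (m : ℕ) : ℝ := if Even m then 1 else 0

end MAdicTree

namespace MAdicTree

variable {m : ℕ}

-- Write D for the subgroup of elements of H given by words with equal exponent sums in a and b
-- (`diagSubgroup`). The point is that St_H(1) is a fibre product over H modulo D. Each time a word
-- moves a letter past the last one, a contributes a and b contributes b⁻¹ to the section, and both
-- raise the difference (exponent of a) − (exponent of b) by 1. For an element trivial on level 1
-- this difference is therefore the same k at every letter, so all sections lie in the single coset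
-- a^k D. Conversely every such tuple comes from H: ab⁻¹ = (ab, 1, …, 1) and a^m = (a, …, a), and
-- conjugating by powers of a produces every element of D in every coordinate
-- (`assemble_mem_bsvGroup`).
--
-- Counting tuples modulo St(n) gives |H : St_H(n+1)| = m · |H : St_H(n)| · |D : St_D(n)|^(m−1). It
-- remains to compare H with D. The quotient H / D·St_H(n) is cyclic, generated by a, and its order
-- follows from the lattice of exponent pairs realised by words fixing level n. The section formulas
-- give a recursion for this lattice; the order is m^⌊n/2⌋, doubled when m is even and n is odd
-- (`relIndex_bsvGroup_eq`). Exponent sums are treated as a relation, so it is never needed that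
-- they are determined by the group element.
--
-- Taking logarithms gives an affine recursion whose solution is the claimed dimension times log_m
-- |Γ_m : St(n)|, plus an error between 0 and n (`bsvLog_bounds`). As log_m |Γ_m : St(n)| grows
-- faster than n, the ratio converges. For the Hausdorff dimension, covers by cosets of St(n) give
-- the upper bound, and the mass distribution principle for Haar measure on the compact closure
-- gives the lower bound.

@[ext]
theorem Gamma.ext_act {g h : Gamma m} (H : ∀ v, act g v = act h v) : g = h :=
  Subtype.ext (RelIso.ext H)

theorem act_one (v : List (Fin m)) : act (1 : Gamma m) v = v := rfl

theorem act_inv_act (g : Gamma m) (v : List (Fin m)) : act g⁻¹ (act g v) = v := by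
  rw [← act_mul, inv_mul_cancel, act_one]

theorem act_act_inv (g : Gamma m) (v : List (Fin m)) : act g (act g⁻¹ v) = v := by
  rw [← act_mul, mul_inv_cancel, act_one]

theorem act_nil (g : Gamma m) : act g [] = [] :=
  List.length_eq_zero_iff.1 (act_length g [])

theorem act_append_singleton (g : Gamma m) (v : List (Fin m)) :
    ∃ k : ℤ, ∀ x, act g (v ++ [x]) = act g v ++ [(finRotate m ^ k) x] := g.2 v

-- Root action, sections, and assembling elements from sections

/-- The exponent of the label at the root. -/
noncomputable def rootExp (g : Gamma m) : ℤ := (act_append_singleton g []).choose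

/-- The action on the first letter. -/
noncomputable def rootFun (g : Gamma m) (x : Fin m) : Fin m := (finRotate m ^ rootExp g) x

theorem act_singleton (g : Gamma m) (x : Fin m) : act g [x] = [rootFun g x] := by
  have := (act_append_singleton g []).choose_spec x
  exact this.trans (congrArg (· ++ [rootFun g x]) (act_nil g))

theorem act_cons_eq (g : Gamma m) (x : Fin m) (u : List (Fin m)) :
    act g (x :: u) = rootFun g x :: (act g (x :: u)).tail := by
  induction u using List.reverseRecOn with
  | nil => simp [act_singleton]
  | append_singleton u y ih =>
    obtain ⟨k, hk⟩ := act_append_singleton g (x :: u)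
    have h1 : act g (x :: (u ++ [y])) = act g (x :: u) ++ [(finRotate m ^ k) y] := hk y
    rw [h1, ih]
    simp

theorem rootFun_mul (g h : Gamma m) (x : Fin m) :
    rootFun (g * h) x = rootFun g (rootFun h x) := by
  have := act_mul g h [x]
  simpa [act_singleton] using this

theorem rootFun_one (x : Fin m) : rootFun (1 : Gamma m) x = x := by
  have := act_one [x]
  simpa [act_singleton] using this

theorem rootFun_inv_rootFun (g : Gamma m) (x : Fin m) : rootFun g⁻¹ (rootFun g x) = x := by
  rw [← rootFun_mul, inv_mul_cancel, rootFun_one]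

theorem rootFun_rootFun_inv (g : Gamma m) (x : Fin m) : rootFun g (rootFun g⁻¹ x) = x := by
  rw [← rootFun_mul, mul_inv_cancel, rootFun_one]

/-- The permutation of the first level, as a homomorphism. -/
noncomputable def rootPerm : Gamma m →* Equiv.Perm (Fin m) where
  toFun g := ⟨rootFun g, rootFun g⁻¹, rootFun_inv_rootFun g, rootFun_rootFun_inv g⟩
  map_one' := by ext x; simp [rootFun_one]
  map_mul' g h := by ext x; simp [rootFun_mul]

theorem rootPerm_apply (g : Gamma m) (x : Fin m) : rootPerm g x = rootFun g x := rfl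

theorem rootPerm_eq (g : Gamma m) : rootPerm g = finRotate m ^ rootExp g := by
  ext x; rfl

theorem section_inverse (g : Gamma m) (x : Fin m) (u : List (Fin m)) :
    (act g⁻¹ (rootFun g x :: (act g (x :: u)).tail)).tail = u := by
  rw [← act_cons_eq, act_inv_act, List.tail_cons]

/-- The section of `g` at the vertex `x` of the first level. -/
noncomputable def sec (g : Gamma m) (x : Fin m) : Gamma m :=
  Gamma.ofPerm
    ⟨fun u => (act g (x :: u)).tail, fun u => (act g⁻¹ (rootFun g x :: u)).tail,
      section_inverse g x, fun u => by
        have := section_inverse g⁻¹ (rootFun g x) u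
        rwa [rootFun_inv_rootFun, inv_inv] at this⟩
    (fun v => by
      obtain ⟨k, hk⟩ := act_append_singleton g (x :: v)
      refine ⟨k, fun y => ?_⟩
      have h1 : act g (x :: (v ++ [y])) = act g (x :: v) ++ [(finRotate m ^ k) y] := hk y
      simp only [Equiv.coe_fn_mk]
      rw [h1, act_cons_eq g x v]
      simp)

theorem act_cons (g : Gamma m) (x : Fin m) (u : List (Fin m)) :
    act g (x :: u) = rootFun g x :: act (sec g x) u := act_cons_eq g x u

theorem eq_of_root_of_sec {g h : Gamma m} (hr : ∀ x, rootFun g x = rootFun h x)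
    (hs : ∀ x, sec g x = sec h x) : g = h := by
  ext v : 1
  cases v with
  | nil => rw [act_nil, act_nil]
  | cons x u => rw [act_cons, act_cons, hr, hs]

theorem sec_eq_of_act {g h : Gamma m} {x y : Fin m} (H : ∀ u, act g (x :: u) = y :: act h u) :
    sec g x = h := by
  ext u : 1
  have := H u
  rw [act_cons] at this
  exact (List.cons.inj this).2

theorem rootFun_eq_of_act {g h : Gamma m} {x y : Fin m} (H : ∀ u, act g (x :: u) = y :: act h u) :
    rootFun g x = y := by
  have := H []
  rw [act_cons] at this
  exact (List.cons.inj this).1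

theorem sec_mul (g h : Gamma m) (x : Fin m) :
    sec (g * h) x = sec g (rootFun h x) * sec h x :=
  sec_eq_of_act (y := rootFun g (rootFun h x)) fun u => by
    rw [act_mul, act_cons, act_cons, act_mul]

theorem sec_one (x : Fin m) : sec (1 : Gamma m) x = 1 :=
  sec_eq_of_act (y := x) fun _ => rfl

theorem sec_inv (g : Gamma m) (x : Fin m) : sec g⁻¹ x = (sec g (rootFun g⁻¹ x))⁻¹ := by
  rw [eq_inv_iff_mul_eq_one]
  have := sec_mul g⁻¹ g (rootFun g⁻¹ x)
  rwa [inv_mul_cancel, sec_one, rootFun_rootFun_inv, eq_comm] at this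

/-- The action on words of the element with trivial root label and given sections. -/
def assembleFun (f : Fin m → Gamma m) : List (Fin m) → List (Fin m)
  | [] => []
  | x :: u => x :: act (f x) u

theorem assembleFun_mul (f f' : Fin m → Gamma m) (v : List (Fin m)) :
    assembleFun (f * f') v = assembleFun f (assembleFun f' v) := by
  cases v <;> simp [assembleFun, act_mul]

theorem assembleFun_one (v : List (Fin m)) : assembleFun (1 : Fin m → Gamma m) v = v := by
  cases v <;> simp [assembleFun, act_one]

/-- The element with trivial root label and given sections. -/
def assemble : (Fin m → Gamma m) →* Gamma m where
  toFun f := Gamma.ofPerm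
    ⟨assembleFun f, assembleFun f⁻¹,
      fun v => by rw [← assembleFun_mul, inv_mul_cancel, assembleFun_one],
      fun v => by rw [← assembleFun_mul, mul_inv_cancel, assembleFun_one]⟩
    (fun v => by
      cases v with
      | nil => exact ⟨0, fun x => by simp [assembleFun, act_nil]⟩
      | cons y u =>
        obtain ⟨k, hk⟩ := act_append_singleton (f y) u
        exact ⟨k, fun x => by simp [assembleFun, hk]⟩)
  map_one' := Gamma.ext_act assembleFun_one
  map_mul' f f' := Gamma.ext_act (assembleFun_mul f f')

theorem act_assemble_cons (f : Fin m → Gamma m) (x : Fin m) (u : List (Fin m)) :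
    act (assemble f) (x :: u) = x :: act (f x) u := rfl

theorem rootFun_assemble (f : Fin m → Gamma m) (x : Fin m) : rootFun (assemble f) x = x :=
  rootFun_eq_of_act (h := f x) (act_assemble_cons f x)

theorem sec_assemble (f : Fin m → Gamma m) (x : Fin m) : sec (assemble f) x = f x :=
  sec_eq_of_act (act_assemble_cons f x)

-- Level stabilizers and the index recursion

theorem mem_levelStabilizer_one {g : Gamma m} :
    g ∈ levelStabilizer m 1 ↔ ∀ x, rootFun g x = x := by
  constructor
  · intro h x
    have := h [x] rfl
    simpa [act_singleton] using this
  · intro h v hv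
    obtain ⟨x, rfl⟩ := List.length_eq_one_iff.1 hv
    rw [act_singleton, h]

theorem levelStabilizer_zero : levelStabilizer m 0 = ⊤ := by
  refine eq_top_iff.2 fun g _ v hv => ?_
  rw [List.length_eq_zero_iff.1 hv, act_nil]

theorem ker_rootPerm : (rootPerm (m := m)).ker = levelStabilizer m 1 := by
  ext g
  rw [MonoidHom.mem_ker, mem_levelStabilizer_one, Equiv.ext_iff]
  rfl

theorem assemble_sec {g : Gamma m} (h : g ∈ levelStabilizer m 1) : assemble (sec g) = g :=
  eq_of_root_of_sec
    (fun x => by rw [rootFun_assemble, mem_levelStabilizer_one.1 h])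
    (fun x => sec_assemble _ x)

theorem range_assemble : (assemble (m := m)).range = levelStabilizer m 1 := by
  ext g
  constructor
  · rintro ⟨f, rfl⟩
    exact mem_levelStabilizer_one.2 (rootFun_assemble f)
  · exact fun h => ⟨sec g, assemble_sec h⟩

theorem assemble_mem_levelStabilizer {f : Fin m → Gamma m} {n : ℕ} :
    assemble f ∈ levelStabilizer m (n + 1) ↔ ∀ x, f x ∈ levelStabilizer m n := by
  constructor
  · intro h x v hv
    have := h (x :: v) (by simp [hv])
    rw [act_assemble_cons] at this
    exact (List.cons.inj this).2
  · intro h v hv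
    cases v with
    | nil => simp at hv
    | cons x u => rw [act_assemble_cons, h x u (by simpa using hv)]

theorem mem_levelStabilizer_of_assemble {g : Gamma m} {n : ℕ}
    (hg : g ∈ levelStabilizer m (n + 1)) :
    assemble (sec g) = g ∧ ∀ x, sec g x ∈ levelStabilizer m n := by
  have h1 := assemble_sec (levelStabilizer_antitone m (Nat.le_add_left 1 n) hg)
  exact ⟨h1, assemble_mem_levelStabilizer.1 (h1.symm ▸ hg)⟩

instance levelStabilizer_normal (n : ℕ) : (levelStabilizer m n).Normal where
  conj_mem g hg k v hv := by
    rw [mul_assoc, act_mul, act_mul, hg _ ((act_length _ _).trans hv), act_act_inv]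

theorem relIndex_levelStabilizer_one (hm : 2 ≤ m) {G : Subgroup (Gamma m)}
    (hG : ∃ g ∈ G, rootPerm g = finRotate m) : (levelStabilizer m 1).relIndex G = m := by
  have h1 : G.map rootPerm = Subgroup.zpowers (finRotate m) := by
    refine le_antisymm ?_ ?_
    · rintro _ ⟨g, -, rfl⟩
      exact ⟨rootExp g, (rootPerm_eq g).symm⟩
    · obtain ⟨g, hg, h⟩ := hG
      exact Subgroup.zpowers_le.2 ⟨g, hg, h⟩
  rw [← ker_rootPerm, Subgroup.relIndex_ker, h1, Nat.card_zpowers]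
  obtain ⟨k, rfl⟩ := Nat.exists_eq_add_of_le' hm
  rw [isCycle_finRotate.orderOf, support_finRotate, Finset.card_univ, Fintype.card_fin]

/-- If the first level stabilizer of `G` consists of the elements whose sections lie in a common
left coset `c N` with `c ∈ G`, this gives a recursion for the orders of the congruence quotients. -/
theorem relIndex_levelStabilizer_succ (hm : 2 ≤ m) {G N : Subgroup (Gamma m)} (hN : N ≤ G)
    (hG : ∃ g ∈ G, rootPerm g = finRotate m)
    (hD : ∀ f : Fin m → Gamma m, assemble f ∈ G ↔ ∃ c ∈ G, ∀ i, c⁻¹ * f i ∈ N) (n : ℕ) :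
    (levelStabilizer m (n + 1)).relIndex G = m * (levelStabilizer m n).relIndex G *
      (levelStabilizer m n).relIndex N ^ (m - 1) := by
  have hS : levelStabilizer m (n + 1) ≤ levelStabilizer m 1 :=
    levelStabilizer_antitone m (Nat.le_add_left 1 n)
  have h1 := Subgroup.relIndex_mul_relIndex (levelStabilizer m (n + 1) ⊓ G)
    (levelStabilizer m 1 ⊓ G) G (inf_le_inf_right _ hS) inf_le_right
  have hmap : (G.comap assemble).map assemble = levelStabilizer m 1 ⊓ G := by
    rw [Subgroup.map_comap_eq, range_assemble]
  have h2 : (levelStabilizer m (n + 1) ⊓ G).relIndex (levelStabilizer m 1 ⊓ G) =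
      (levelStabilizer m (n + 1)).relIndex ((G.comap assemble).map assemble) := by
    rw [hmap, ← Subgroup.inf_relIndex_right (levelStabilizer m (n + 1)), ← inf_assoc,
      inf_eq_left.2 hS]
  rw [Subgroup.inf_relIndex_right, Subgroup.inf_relIndex_right, relIndex_levelStabilizer_one hm hG, h2,
    ← Subgroup.relIndex_comap] at h1
  let π : Gamma m →* Gamma m ⧸ levelStabilizer m n := QuotientGroup.mk' _
  let Φ : (Fin m → Gamma m) →* (Fin m → Gamma m ⧸ levelStabilizer m n) :=
    MonoidHom.pi fun i => π.comp (Pi.evalMonoidHom _ i)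
  have hker : (levelStabilizer m (n + 1)).comap assemble = Φ.ker := by
    ext f
    rw [Subgroup.mem_comap, assemble_mem_levelStabilizer, MonoidHom.mem_ker, funext_iff]
    exact forall_congr' fun i => (QuotientGroup.eq_one_iff _).symm
  have hπ : ∀ K : Subgroup (Gamma m), (levelStabilizer m n).relIndex K = Nat.card (K.map π) :=
    fun K => by rw [← Subgroup.relIndex_ker, QuotientGroup.ker_mk']
  have : NeZero m := ⟨by omega⟩
  -- The coset representative can be taken to be the coordinate at 0. This parametrises the image by
  -- one free element of G modulo St(n) and m − 1 free elements of N modulo St(n).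
  have hmem : ∀ x, x ∈ (G.comap assemble).map Φ ↔
      x 0 ∈ G.map π ∧ ∀ i, (x 0)⁻¹ * x i ∈ N.map π := by
    intro x
    constructor
    · rintro ⟨f, hf, rfl⟩
      obtain ⟨c, hc, hcf⟩ := (hD f).1 hf
      refine ⟨⟨f 0, ?_, rfl⟩, fun i => ⟨(c⁻¹ * f 0)⁻¹ * (c⁻¹ * f i),
        mul_mem (inv_mem (hcf 0)) (hcf i), ?_⟩⟩
      · simpa using mul_mem hc (hN (hcf 0))
      · have : (c⁻¹ * f 0)⁻¹ * (c⁻¹ * f i) = (f 0)⁻¹ * f i := by group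
        rw [this, map_mul, map_inv]
        rfl
    · rintro ⟨⟨g, hg, hgx⟩, h⟩
      choose k hk hkx using h
      refine ⟨fun i => g * k i, (hD _).2 ⟨g, hg, fun i => by simpa using hk i⟩, ?_⟩
      funext i
      change π (g * k i) = x i
      rw [map_mul, hgx, hkx, mul_inv_cancel_left]
  let e : (G.comap assemble).map Φ ≃ (G.map π) × ({i : Fin m // i ≠ 0} → N.map π) :=
    { toFun := fun x => (⟨x.1 0, ((hmem _).1 x.2).1⟩, fun i => ⟨_, ((hmem _).1 x.2).2 i⟩)
      invFun := fun p => ⟨fun i => if h : i = 0 then p.1 else p.1 * (p.2 ⟨i, h⟩ : _),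
        (hmem _).2 ⟨by simp, fun i => by
          by_cases h : i = 0
          · simp [h, one_mem]
          · simp only [h, dite_true, dite_false, inv_mul_cancel_left]
            exact (p.2 _).2⟩⟩
      left_inv := fun x => by
        ext i
        by_cases h : i = 0 <;> simp [h]
      right_inv := fun p => by
        ext i
        · simp
        · have := i.2
          simp [this] }
  have hcard : Nat.card {i : Fin m // i ≠ 0} = m - 1 := by simp
  rw [hker, Subgroup.relIndex_ker, Nat.card_congr e, Nat.card_prod, Nat.card_fun, hcard,
    ← hπ, ← hπ] at h1
  rw [← h1]
  ring

-- Exponent sums of words and of their sections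

/-- `HasExponents g s t`: `g` is represented by a word in `a` and `b` with exponent sums
`s` in `a` and `t` in `b`. -/
inductive HasExponents : Gamma m → ℤ → ℤ → Prop
  | one : HasExponents 1 0 0
  | genA : HasExponents (genA m) 1 0
  | genB : HasExponents (genB m) 0 1
  | mul {g h : Gamma m} {s t s' t' : ℤ} :
      HasExponents g s t → HasExponents h s' t' → HasExponents (g * h) (s + s') (t + t')
  | inv {g : Gamma m} {s t : ℤ} : HasExponents g s t → HasExponents g⁻¹ (-s) (-t)

theorem HasExponents.congr {g : Gamma m} {s t s' t' : ℤ} (h : HasExponents g s t) (hs : s = s')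
    (ht : t = t') : HasExponents g s' t' := hs ▸ ht ▸ h

theorem mem_bsvGroup {g : Gamma m} : g ∈ bsvGroup m ↔ ∃ s t, HasExponents g s t := by
  constructor
  · intro h
    induction h using Subgroup.closure_induction with
    | mem x hx =>
      rcases hx with rfl | rfl
      · exact ⟨_, _, .genA⟩
      · exact ⟨_, _, .genB⟩
    | one => exact ⟨_, _, .one⟩
    | mul x y _ _ hx hy =>
      obtain ⟨s, t, h⟩ := hx
      obtain ⟨s', t', h'⟩ := hy
      exact ⟨_, _, h.mul h'⟩
    | inv x _ hx =>
      obtain ⟨s, t, h⟩ := hx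
      exact ⟨_, _, h.inv⟩
  · rintro ⟨s, t, h⟩
    induction h with
    | one => exact one_mem _
    | genA => exact Subgroup.subset_closure (by simp)
    | genB => exact Subgroup.subset_closure (by simp)
    | mul _ _ h h' => exact mul_mem h h'
    | inv _ h => exact inv_mem h

theorem HasExponents.zpow {g : Gamma m} {s t : ℤ} (h : HasExponents g s t) (k : ℤ) :
    HasExponents (g ^ k) (k * s) (k * t) := by
  induction k using Int.induction_on with
  | zero => simpa using HasExponents.one
  | succ i ih =>
    rw [zpow_add_one]
    exact (ih.mul h).congr (by ring) (by ring)
  | pred i ih =>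
    rw [zpow_sub_one]
    exact (ih.mul h.inv).congr (by ring) (by ring)

theorem HasExponents.genA_zpow (k : ℤ) : HasExponents (MAdicTree.genA m ^ k) k 0 :=
  (HasExponents.genA.zpow k).congr (by ring) (by ring)

theorem finRotate_val (hm : 2 ≤ m) (x : Fin m) :
    ((finRotate m x : ℕ) : ℤ) = ((x : ℕ) + 1 : ℤ) % m := by
  obtain ⟨k, rfl⟩ := Nat.exists_eq_add_of_le' hm
  rw [finRotate_apply, Fin.val_add]
  simp

theorem finRotate_zpow_val (hm : 2 ≤ m) (n : ℤ) (x : Fin m) :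
    (((finRotate m ^ n) x : ℕ) : ℤ) = ((x : ℕ) + n : ℤ) % m := by
  have hx : ((x : ℕ) : ℤ) < m := by exact_mod_cast x.2
  induction n using Int.induction_on with
  | zero => rw [zpow_zero, add_zero, Int.emod_eq_of_lt (by positivity) hx]; rfl
  | succ i ih =>
    rw [add_comm (i : ℤ), zpow_add, zpow_one, Equiv.Perm.mul_apply, finRotate_val hm, ih,
      Int.emod_add_emod]
    ring_nf
  | pred i ih =>
    have h1 : finRotate m ((finRotate m ^ (-(i : ℤ) - 1)) x) = (finRotate m ^ (-(i : ℤ))) x := by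
      rw [← Equiv.Perm.mul_apply, ← zpow_one_add]
      ring_nf
    set y := (finRotate m ^ (-(i : ℤ) - 1)) x
    have h2 := finRotate_val hm y
    rw [h1, ih] at h2
    have h3 : ((x : ℕ) + (-(i : ℤ) - 1)) % m = ((y : ℕ) : ℤ) % m := by
      have h4 : ((x : ℕ) + (-(i : ℤ))) ≡ ((y : ℕ) : ℤ) + 1 [ZMOD m] := h2
      have := h4.sub_right 1
      rw [add_sub_cancel_right, add_sub_assoc] at this
      exact this
    rw [h3, Int.emod_eq_of_lt (by positivity) (by exact_mod_cast y.2)]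

/-- The carry ⌊(x + n)/m⌋ is a cocycle over the rotation of the letters. It records the exponent
difference of a section, so this identity propagates that difference through products and inverses.
-/
theorem val_add_ediv_add (hm : 2 ≤ m) (x : Fin m) (n n' : ℤ) :
    (((finRotate m ^ n) x : ℕ) + n') / (m : ℤ) + ((x : ℕ) + n) / (m : ℤ) =
      ((x : ℕ) + (n + n')) / (m : ℤ) := by
  rw [finRotate_zpow_val hm]
  have h1 := Int.emod_add_mul_ediv ((x : ℕ) + n : ℤ) m
  have h2 : ((x : ℕ) + (n + n') : ℤ) =
      ((x : ℕ) + n : ℤ) % m + n' + ((x : ℕ) + n : ℤ) / m * m := by linarith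
  rw [h2, Int.add_mul_ediv_right _ _ (by omega)]

theorem val_ediv (x : Fin m) : ((x : ℕ) : ℤ) / (m : ℤ) = 0 :=
  Int.ediv_eq_zero_of_lt (by positivity) (by exact_mod_cast x.2)

theorem val_add_one_ediv (hm : 2 ≤ m) (x : Fin m) :
    ((x : ℕ) + 1 : ℤ) / (m : ℤ) = if (x : ℕ) + 1 = m then 1 else 0 := by
  split_ifs with h
  · have : ((x : ℕ) + 1 : ℤ) = m := by exact_mod_cast h
    rw [this, Int.ediv_self (by omega)]
  · have := x.2
    exact Int.ediv_eq_zero_of_lt (by positivity) (by omega)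

theorem act_genA_cons (x : Fin m) (u : List (Fin m)) :
    act (genA m) (x :: u) =
      finRotate m x :: act (if (x : ℕ) + 1 = m then genA m else 1) u := by
  split_ifs with h
  · change aFun (x :: u) = _ :: aFun u
    rw [aFun, if_pos h]
  · change aFun (x :: u) = _ :: u
    rw [aFun, if_neg h]

theorem act_genB_cons (x : Fin m) (u : List (Fin m)) :
    act (genB m) (x :: u) =
      finRotate m x :: act (if (x : ℕ) + 1 = m then (genB m)⁻¹ else 1) u := by
  split_ifs with h
  · change bFun (x :: u) = _ :: bInvFun u
    rw [bFun, if_pos h]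
  · change bFun (x :: u) = _ :: u
    rw [bFun, if_neg h]

theorem rootFun_genA (x : Fin m) : rootFun (genA m) x = finRotate m x :=
  rootFun_eq_of_act (act_genA_cons x)

theorem rootFun_genB (x : Fin m) : rootFun (genB m) x = finRotate m x :=
  rootFun_eq_of_act (act_genB_cons x)

theorem sec_genA (x : Fin m) : sec (genA m) x = if (x : ℕ) + 1 = m then genA m else 1 :=
  sec_eq_of_act (act_genA_cons x)

theorem sec_genB (x : Fin m) : sec (genB m) x = if (x : ℕ) + 1 = m then (genB m)⁻¹ else 1 :=
  sec_eq_of_act (act_genB_cons x)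

theorem rootPerm_genA : rootPerm (genA m) = finRotate m := Equiv.ext rootFun_genA

theorem rootPerm_genB : rootPerm (genB m) = finRotate m := Equiv.ext rootFun_genB

theorem HasExponents.rootPerm {g : Gamma m} {s t : ℤ} (h : HasExponents g s t) :
    rootPerm g = finRotate m ^ (s + t) := by
  induction h with
  | one => simp
  | genA => simp [rootPerm_genA]
  | genB => simp [rootPerm_genB]
  | mul _ _ h h' =>
    rw [map_mul, h, h', ← zpow_add]
    ring_nf
  | inv _ h =>
    rw [map_inv, h, ← zpow_neg]
    ring_nf

theorem HasExponents.rootFun {g : Gamma m} {s t : ℤ} (h : HasExponents g s t) (x : Fin m) :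
    rootFun g x = (finRotate m ^ (s + t)) x := by
  rw [← h.rootPerm]
  rfl

theorem sum_ite_last (hm : 2 ≤ m) (c : ℤ) :
    ∑ x : Fin m, (if (x : ℕ) + 1 = m then c else 0) = c := by
  have h : ∀ x : Fin m, (x : ℕ) + 1 = m ↔ x = ⟨m - 1, by omega⟩ := fun x => by
    rw [Fin.ext_iff]
    simp only
    omega
  simp [h]

/-- The exponents of the sections of a word in `a` and `b`. -/
theorem HasExponents.sec (hm : 2 ≤ m) {g : Gamma m} {s t : ℤ} (h : HasExponents g s t) :
    ∃ l : Fin m → ℤ, ∑ x, l x = -t ∧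
      ∀ x, HasExponents (sec g x) (((x : ℕ) + (s + t)) / (m : ℤ) + l x) (l x) := by
  induction h with
  | one =>
    refine ⟨0, by simp, fun x => ?_⟩
    rw [sec_one]
    exact HasExponents.one.congr (by simp [val_ediv]) rfl
  | genA =>
    refine ⟨0, by simp, fun x => ?_⟩
    rw [sec_genA, add_zero, val_add_one_ediv hm]
    split_ifs
    · exact HasExponents.genA
    · exact HasExponents.one
  | genB =>
    refine ⟨fun x => if (x : ℕ) + 1 = m then -1 else 0, sum_ite_last hm _, fun x => ?_⟩
    rw [sec_genB, zero_add, val_add_one_ediv hm]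
    dsimp only
    split_ifs
    · exact HasExponents.genB.inv.congr (by ring) (by ring)
    · exact HasExponents.one
  | @mul g h s t s' t' _ hh ihg ihh =>
    obtain ⟨l, hl, hls⟩ := ihg
    obtain ⟨l', hl', hls'⟩ := ihh
    refine ⟨fun x => l ((finRotate m ^ (s' + t')) x) + l' x, ?_, fun x => ?_⟩
    · rw [Finset.sum_add_distrib, Equiv.sum_comp, hl, hl']
      ring
    · rw [sec_mul, hh.rootFun]
      refine ((hls _).mul (hls' x)).congr ?_ rfl
      have := val_add_ediv_add hm x (s' + t') (s + t)
      rw [show s + s' + (t + t') = s' + t' + (s + t) by ring, ← this]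
      ring
  | @inv g s t hg ih =>
    obtain ⟨l, hl, hls⟩ := ih
    refine ⟨fun x => -l ((finRotate m ^ (-s + -t)) x), ?_, fun x => ?_⟩
    · rw [Finset.sum_neg_distrib, Equiv.sum_comp, hl]
    · rw [sec_inv, hg.inv.rootFun]
      refine (hls _).inv.congr ?_ rfl
      have := val_add_ediv_add hm x (-s + -t) (s + t)
      rw [show -s + -t + (s + t) = 0 by ring, add_zero, val_ediv] at this
      linarith

/-- When the root action is trivial the carry does not depend on the letter, which is why one k
serves all sections. -/
theorem HasExponents.of_assemble (hm : 2 ≤ m) {f : Fin m → Gamma m} {s t : ℤ}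
    (h : HasExponents (assemble f) s t) :
    ∃ (k : ℤ) (l : Fin m → ℤ), s + t = m * k ∧ ∑ x, l x = -t ∧
      ∀ x, HasExponents (f x) (k + l x) (l x) := by
  have : NeZero m := ⟨by omega⟩
  obtain ⟨l, hl, hls⟩ := h.sec hm
  -- The letter 0 is fixed by the rotation by s + t, so m divides s + t.
  have h1 := h.rootFun 0
  rw [rootFun_assemble] at h1
  have h2 := finRotate_zpow_val hm (s + t) 0
  rw [← h1] at h2
  simp only [Fin.val_zero, Nat.cast_zero, zero_add] at h2
  obtain ⟨k, hk⟩ := Int.dvd_of_emod_eq_zero h2.symm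
  refine ⟨k, l, hk, hl, fun x => ?_⟩
  have h3 := hls x
  rw [sec_assemble] at h3
  refine h3.congr ?_ rfl
  rw [hk, Int.add_mul_ediv_left _ _ (by omega), val_ediv]
  ring

-- Which tuples of sections assemble to elements of H

theorem sec_genA_pow (hm : 2 ≤ m) (i : ℕ) (hi : i ≤ m) (x : Fin m) :
    sec (genA m ^ i) x = if m ≤ x + i then genA m else 1 := by
  induction i generalizing x with
  | zero => simp [sec_one, x.2]
  | succ i ih =>
    have h1 : rootFun (genA m ^ i) x = (finRotate m ^ (i : ℤ)) x := by
      have := (HasExponents.genA_zpow (m := m) i).rootFun x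
      simpa using this
    have h2 := finRotate_zpow_val hm i x
    rw [pow_succ', sec_mul, ih (by omega), sec_genA, h1]
    have hx := x.2
    rcases lt_or_ge ((x : ℕ) + i) m with h | h
    · rw [Int.emod_eq_of_lt (by positivity) (by omega)] at h2
      have h3 : (((finRotate m ^ (i : ℤ)) x : Fin m) : ℕ) = x + i := by exact_mod_cast h2
      rw [h3, if_neg (show ¬ m ≤ (x : ℕ) + i by omega), mul_one]
      exact if_congr (by omega) rfl rfl
    · have h4 : ((x : ℕ) + i : ℤ) % m = x + i - m := by
        rw [← Int.sub_emod_right, Int.emod_eq_of_lt (by omega) (by omega)]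
      rw [h4] at h2
      rw [if_neg (show ¬ (((finRotate m ^ (i : ℤ)) x : Fin m) : ℕ) + 1 = m by omega), if_pos h,
        if_pos (by omega), one_mul]

theorem genA_zpow_mul_card (hm : 2 ≤ m) : genA m ^ (m : ℤ) = assemble fun _ => genA m := by
  refine eq_of_root_of_sec (fun x => ?_) fun x => ?_
  · rw [(HasExponents.genA_zpow (m := m) m).rootFun, rootFun_assemble, Fin.ext_iff]
    have := finRotate_zpow_val hm m x
    rw [Int.add_emod_right, Int.emod_eq_of_lt (by positivity) (by exact_mod_cast x.2)] at this
    rw [add_zero]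
    exact_mod_cast this
  · rw [sec_assemble, zpow_natCast, sec_genA_pow hm m le_rfl, if_pos (by omega)]

theorem assemble_const_genA_zpow (hm : 2 ≤ m) (k : ℤ) :
    (assemble fun _ => genA m ^ k) = genA m ^ (m * k : ℤ) := by
  rw [zpow_mul, genA_zpow_mul_card hm, ← map_zpow]
  rfl

/-- The root rotations cancel, and only the path from 0 back to the last letter and forward again
meets nontrivial sections: b from b⁻¹, then a. This is the seed that puts D into a single
coordinate. -/
theorem genA_mul_genB_inv [NeZero m] (hm : 2 ≤ m) :
    genA m * (genB m)⁻¹ = assemble (Pi.mulSingle 0 (genA m * genB m)) := by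
  have h0 : ∀ x, rootFun (genB m)⁻¹ x = (finRotate m)⁻¹ x := fun x => by
    rw [← rootPerm_apply, map_inv, rootPerm_genB]
  refine eq_of_root_of_sec (fun x => ?_) fun x => ?_
  · rw [rootFun_mul, rootFun_assemble, h0, rootFun_genA, ← Equiv.Perm.mul_apply, mul_inv_cancel,
      Equiv.Perm.one_apply]
  · rw [sec_mul, sec_inv, sec_assemble, h0, sec_genA, sec_genB]
    obtain ⟨y, rfl⟩ := (finRotate m).surjective x
    rw [← Equiv.Perm.mul_apply, inv_mul_cancel, Equiv.Perm.one_apply]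
    have h1 : (y : ℕ) + 1 = m ↔ finRotate m y = 0 := by
      have h2 := finRotate_val hm y
      have hy := y.2
      rw [Fin.ext_iff, Fin.val_zero]
      constructor
      · intro h
        have : ((y : ℕ) + 1 : ℤ) = m := by exact_mod_cast h
        rw [this, Int.emod_self] at h2
        exact_mod_cast h2
      · intro h
        rw [h] at h2
        obtain ⟨c, hc⟩ := Int.dvd_of_emod_eq_zero h2.symm
        have : (m : ℤ) ∣ ((y + 1 : ℕ) : ℤ) := ⟨c, by push_cast; exact hc⟩
        have := Nat.le_of_dvd (by omega) (Int.natCast_dvd_natCast.1 this)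
        omega
    by_cases h : finRotate m y = 0
    · rw [if_pos (h1.2 h), if_pos (h1.2 h), h, Pi.mulSingle_eq_same, inv_inv]
    · rw [if_neg (mt h1.1 h), if_neg (mt h1.1 h), Pi.mulSingle_eq_of_ne h, inv_one, mul_one]

theorem HasExponents.conj_genA_zpow {n : Gamma m} {s t : ℤ} (h : HasExponents n s t) (k : ℤ) :
    HasExponents (MAdicTree.genA m ^ (-k) * n * MAdicTree.genA m ^ k) s t :=
  (((genA_zpow (-k)).mul h).mul (genA_zpow k)).congr (by ring) (by ring)

/-- The factor a^(t − s) moves an arbitrary word into D, so that induction on all words is possible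
even though subwords of a word for an element of D need not lie in D. -/
theorem HasExponents.assemble_mulSingle_zero_aux [NeZero m] (hm : 2 ≤ m) {g : Gamma m} {s t : ℤ}
    (h : HasExponents g s t) :
    HasExponents (assemble (Pi.mulSingle 0 (MAdicTree.genA m ^ (t - s) * g))) t (-t) := by
  -- Conjugating by a^k inside the coordinate is conjugating by a^(mk) = (a^k, …, a^k) outside,
  -- which keeps the exponents. The products and inverses below differ from the normalised ones by
  -- such conjugations.
  have hconj : ∀ (n : Gamma m) (l k : ℤ), HasExponents (assemble (Pi.mulSingle 0 n)) l (-l) →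
      HasExponents (assemble (Pi.mulSingle 0
        (MAdicTree.genA m ^ (-k) * n * MAdicTree.genA m ^ k))) l (-l) := by
    intro n l k hn
    have h1 := hn.conj_genA_zpow (m * k)
    rw [← mul_neg, ← assemble_const_genA_zpow hm, ← assemble_const_genA_zpow hm, ← map_mul,
      ← map_mul] at h1
    convert h1 using 2
    funext i
    rcases eq_or_ne i 0 with rfl | hi
    · simp
    · simp [Pi.mulSingle_eq_of_ne hi]
  induction h with
  | one => simpa using HasExponents.one
  | genA =>
    have : MAdicTree.genA m ^ ((0 : ℤ) - 1) * MAdicTree.genA m = 1 := by group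
    rw [this]
    simpa using HasExponents.one
  | genB =>
    have := genA_mul_genB_inv (m := m) hm
    simp only [sub_zero, zpow_one]
    rw [← this]
    exact (HasExponents.genA.mul HasExponents.genB.inv).congr (by ring) (by ring)
  | @mul g h s t s' t' _ _ ihg ihh =>
    have h1 : MAdicTree.genA m ^ (t + t' - (s + s')) * (g * h) =
        (MAdicTree.genA m ^ (-(s' - t')) * (MAdicTree.genA m ^ (t - s) * g) *
          MAdicTree.genA m ^ (s' - t')) * (MAdicTree.genA m ^ (t' - s') * h) := by
      group
    rw [h1, Pi.mulSingle_mul, map_mul]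
    exact ((hconj _ _ (s' - t') ihg).mul ihh).congr rfl (by ring)
  | @inv g s t _ ih =>
    have h1 : MAdicTree.genA m ^ (-t - -s) * g⁻¹ =
        MAdicTree.genA m ^ (-(t - s)) * (MAdicTree.genA m ^ (t - s) * g)⁻¹ *
          MAdicTree.genA m ^ (t - s) := by
      group
    have h2 := ih.inv
    rw [← map_inv, ← Pi.mulSingle_inv] at h2
    rw [h1]
    exact hconj _ _ (t - s) h2

/-- Conjugation by a^x carries coordinate 0 to coordinate x without altering the entry, since x < m
makes the section of a^x at 0 trivial. -/
theorem HasExponents.assemble_mulSingle (hm : 2 ≤ m) {g : Gamma m} {l : ℤ}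
    (h : HasExponents g l l) (x : Fin m) :
    HasExponents (assemble (Pi.mulSingle x g)) l (-l) := by
  have : NeZero m := ⟨by omega⟩
  have h1 := h.assemble_mulSingle_zero_aux hm
  rw [sub_self, zpow_zero, one_mul] at h1
  have h2 := h1.conj_genA_zpow (-(x : ℕ) : ℤ)
  convert h2 using 1
  rw [neg_neg, zpow_neg, zpow_natCast, eq_mul_inv_iff_mul_eq]
  have hrot : ∀ y : Fin m, MAdicTree.rootFun (MAdicTree.genA m ^ (x : ℕ)) y = x ↔ y = 0 := by
    have h3 : MAdicTree.rootFun (MAdicTree.genA m ^ (x : ℕ)) 0 = x := by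
      have h4 := (genA_zpow (m := m) (x : ℕ)).rootFun 0
      have h5 := finRotate_zpow_val hm ((x : ℕ) : ℤ) 0
      rw [add_zero, zpow_natCast] at h4
      rw [h4, Fin.ext_iff]
      rw [Fin.val_zero, Nat.cast_zero, zero_add,
        Int.emod_eq_of_lt (by positivity) (by exact_mod_cast x.2)] at h5
      exact_mod_cast h5
    intro y
    have h6 := (MAdicTree.rootPerm (MAdicTree.genA m ^ (x : ℕ))).injective.eq_iff (a := y) (b := 0)
    rwa [rootPerm_apply, rootPerm_apply, h3] at h6
  refine eq_of_root_of_sec (fun y => ?_) fun y => ?_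
  · simp only [rootFun_mul, rootFun_assemble]
  · rw [sec_mul, sec_mul, sec_assemble, sec_assemble, rootFun_assemble]
    rcases eq_or_ne y 0 with rfl | hy
    · rw [(hrot 0).2 rfl, Pi.mulSingle_eq_same, Pi.mulSingle_eq_same,
        sec_genA_pow hm _ x.2.le, if_neg (by simp), one_mul, mul_one]
    · rw [Pi.mulSingle_eq_of_ne hy, Pi.mulSingle_eq_of_ne (mt (hrot y).1 hy), one_mul, mul_one]

theorem HasExponents.assemble_of_diag (hm : 2 ≤ m) {f : Fin m → Gamma m} {l : Fin m → ℤ}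
    (h : ∀ x, HasExponents (f x) (l x) (l x)) :
    HasExponents (assemble f) (∑ x, l x) (-∑ x, l x) := by
  have key : ∀ S : Finset (Fin m), HasExponents (assemble fun x => if x ∈ S then f x else 1)
      (∑ x ∈ S, l x) (-∑ x ∈ S, l x) := by
    intro S
    induction S using Finset.induction_on with
    | empty =>
      have : (fun x : Fin m => if x ∈ (∅ : Finset (Fin m)) then f x else 1) = 1 := by
        funext x; simp
      rw [this]
      simpa using HasExponents.one
    | insert y S hy ih =>
      have : (fun x : Fin m => if x ∈ insert y S then f x else 1) =
          Pi.mulSingle y (f y) * fun x => if x ∈ S then f x else 1 := by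
        funext x
        rcases eq_or_ne x y with rfl | hx
        · simp [hy]
        · simp [hx]
      rw [this, map_mul, Finset.sum_insert hy]
      exact (((h y).assemble_mulSingle hm y).mul ih).congr rfl (by ring)
  simpa using key Finset.univ

/-- Factoring out (a^k, …, a^k) = a^(mk) leaves a tuple of elements of D. -/
theorem HasExponents.assemble (hm : 2 ≤ m) {f : Fin m → Gamma m} {k : ℤ} {l : Fin m → ℤ}
    (h : ∀ x, HasExponents (f x) (k + l x) (l x)) :
    HasExponents (assemble f) (m * k + ∑ x, l x) (-∑ x, l x) := by
  have h1 : ∀ x, HasExponents (MAdicTree.genA m ^ (-k) * f x) (l x) (l x) := fun x =>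
    ((genA_zpow (-k)).mul (h x)).congr (by ring) (by ring)
  have h2 := (genA_zpow (m := m) (m * k)).mul (assemble_of_diag hm h1)
  rw [← assemble_const_genA_zpow hm, ← map_mul] at h2
  have h3 : ((fun _ => MAdicTree.genA m ^ k) * fun x => MAdicTree.genA m ^ (-k) * f x) = f := by
    funext x
    simp
  rw [h3] at h2
  exact h2.congr rfl (by ring)

-- The subgroup D and the index recursions for H and Γ_m

/-- The elements of the group represented by words with equal exponent sums in `a` and `b`, i.e.
the normal closure of `ab`. -/
def diagSubgroup (m : ℕ) : Subgroup (Gamma m) where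
  carrier := {g | ∃ l, HasExponents g l l}
  one_mem' := ⟨0, .one⟩
  mul_mem' := fun ⟨_, h⟩ ⟨_, h'⟩ => ⟨_, h.mul h'⟩
  inv_mem' := fun ⟨_, h⟩ => ⟨_, h.inv⟩

theorem diagSubgroup_le : diagSubgroup m ≤ bsvGroup m :=
  fun _ ⟨l, h⟩ => mem_bsvGroup.2 ⟨l, l, h⟩

theorem genA_mem : genA m ∈ bsvGroup m := mem_bsvGroup.2 ⟨1, 0, .genA⟩

theorem assemble_mem_bsvGroup (hm : 2 ≤ m) (f : Fin m → Gamma m) :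
    assemble f ∈ bsvGroup m ↔ ∃ c ∈ bsvGroup m, ∀ i, c⁻¹ * f i ∈ diagSubgroup m := by
  constructor
  · intro h
    obtain ⟨s, t, h⟩ := mem_bsvGroup.1 h
    obtain ⟨k, l, -, -, hl⟩ := h.of_assemble hm
    refine ⟨genA m ^ k, zpow_mem genA_mem k, fun i => ⟨l i, ?_⟩⟩
    exact ((HasExponents.genA_zpow k).inv.mul (hl i)).congr (by ring) (by ring)
  · rintro ⟨c, hc, h⟩
    obtain ⟨s, t, hst⟩ := mem_bsvGroup.1 hc
    choose l hl using h
    refine mem_bsvGroup.2 ⟨_, _, HasExponents.assemble hm (k := s - t) (l := fun i => t + l i)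
      fun i => ?_⟩
    have := hst.mul (hl i)
    rw [mul_inv_cancel_left] at this
    exact this.congr (by ring) rfl

theorem relIndex_bsvGroup_succ (hm : 2 ≤ m) (n : ℕ) :
    (levelStabilizer m (n + 1)).relIndex (bsvGroup m) =
      m * (levelStabilizer m n).relIndex (bsvGroup m) *
        (levelStabilizer m n).relIndex (diagSubgroup m) ^ (m - 1) :=
  relIndex_levelStabilizer_succ hm diagSubgroup_le ⟨genA m, genA_mem, rootPerm_genA⟩
    (assemble_mem_bsvGroup hm) n

theorem index_levelStabilizer_succ (hm : 2 ≤ m) (n : ℕ) :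
    (levelStabilizer m (n + 1)).index = m * (levelStabilizer m n).index ^ m := by
  have h := relIndex_levelStabilizer_succ hm (G := ⊤) (N := ⊤) le_rfl
    ⟨genA m, trivial, rootPerm_genA⟩ (fun f => ⟨fun _ => ⟨1, trivial, fun _ => trivial⟩,
      fun _ => trivial⟩) n
  simp only [Subgroup.relIndex_top_right] at h
  rw [h, mul_assoc, ← pow_succ', Nat.sub_add_cancel (by omega)]

-- The lattice of exponent pairs realised in level stabilizers

/-- The pairs `(k, l)` such that some word with exponent sums `(k + l, l)` fixes level `n`. -/
def LevelRelation (m n : ℕ) (k l : ℤ) : Prop :=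
  ∃ g ∈ levelStabilizer m n, HasExponents g (k + l) l

theorem levelRelation_zero (k l : ℤ) : LevelRelation m 0 k l := by
  refine ⟨genA m ^ (k + l) * genB m ^ l, by simp [levelStabilizer_zero], ?_⟩
  exact ((HasExponents.genA_zpow _).mul (HasExponents.genB.zpow l)).congr (by ring) (by ring)

theorem levelRelation_succ (hm : 2 ≤ m) (n : ℕ) (p t : ℤ) :
    LevelRelation m (n + 1) p t ↔ ∃ (k : ℤ) (l : Fin m → ℤ),
      p = m * k - 2 * t ∧ ∑ x, l x = -t ∧ ∀ x, LevelRelation m n k (l x) := by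
  constructor
  · rintro ⟨g, hg, h⟩
    obtain ⟨h1, h2⟩ := mem_levelStabilizer_of_assemble hg
    rw [← h1] at h
    obtain ⟨k, l, hk, hl, hx⟩ := h.of_assemble hm
    exact ⟨k, l, by linarith, hl, fun x => ⟨_, h2 x, hx x⟩⟩
  · rintro ⟨k, l, hk, hl, hx⟩
    choose f hf hfx using hx
    exact ⟨assemble f, assemble_mem_levelStabilizer.2 hf,
      (HasExponents.assemble hm hfx).congr (by linarith) (by linarith)⟩

/-- The relations at level `n` form the lattice spanned by `(q, c)` and `(0, r)`. -/
def IsLevelLattice (m n : ℕ) (q c r : ℤ) : Prop :=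
  ∀ k l, LevelRelation m n k l ↔ ∃ x y : ℤ, k = q * x ∧ l = c * x + r * y

theorem isLevelLattice_zero : IsLevelLattice m 0 1 0 1 := fun k l =>
  ⟨fun _ => ⟨k, l, by ring, by ring⟩, fun _ => levelRelation_zero k l⟩

theorem IsLevelLattice.succ (hm : 2 ≤ m) {n : ℕ} {q c r : ℤ} (hq : q ≠ 0)
    (h : IsLevelLattice m n q c r) (p t : ℤ) : LevelRelation m (n + 1) p t ↔
      ∃ x y : ℤ, p = (m * q + 2 * m * c) * x + 2 * r * y ∧ t = -m * c * x - r * y := by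
  have : NeZero m := ⟨by omega⟩
  rw [levelRelation_succ hm]
  constructor
  · rintro ⟨k, l, hk, hl, hx⟩
    choose x y hkx hlx using fun i => (h k (l i)).1 (hx i)
    -- All sections share k, and q ≠ 0, so they share the coefficient x. The coefficients y remain
    -- free, but only their sum matters.
    have hxc : ∀ i, x i = x 0 := fun i => mul_left_cancel₀ hq ((hkx i).symm.trans (hkx 0))
    have h1 : ∑ i, l i = m * (c * x 0) + r * ∑ i, y i := by
      rw [Finset.mul_sum, Finset.sum_congr rfl fun i _ => (hlx i).trans (by rw [hxc i]),
        Finset.sum_add_distrib]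
      simp
    have ht : t = -m * c * x 0 - r * ∑ i, y i := by linarith
    refine ⟨x 0, ∑ i, y i, ?_, ht⟩
    rw [hk, hkx 0, ht]
    ring
  · rintro ⟨x, y, hp, ht⟩
    refine ⟨q * x, fun i => c * x + r * if i = 0 then y else 0, ?_, ?_,
      fun i => (h _ _).2 ⟨x, _, rfl, rfl⟩⟩
    · rw [hp, ht]
      ring
    · rw [Finset.sum_add_distrib, ← Finset.mul_sum, ← Finset.mul_sum, Finset.sum_ite_eq',
        if_pos (Finset.mem_univ _)]
      simp [ht]
      ring

/-- The generators (mq + 2mc, −mc) and (2r, −r) produced by `IsLevelLattice.succ` are brought back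
to triangular form by a unimodular change of basis, available since m and 2 are coprime. -/
theorem isLevelLattice_of_odd (hm : 2 ≤ m) {h : ℤ} (hh : (m : ℤ) = 2 * h + 1) (j : ℕ) :
    IsLevelLattice m (2 * j) ((m : ℤ) ^ j) 0 ((m : ℤ) ^ j) ∧
      IsLevelLattice m (2 * j + 1) ((m : ℤ) ^ j) (h * (m : ℤ) ^ j) ((m : ℤ) ^ (j + 1)) := by
  have hne : ∀ j : ℕ, (m : ℤ) ^ j ≠ 0 := fun j => pow_ne_zero _ (by omega)
  have step : ∀ j, IsLevelLattice m (2 * j) ((m : ℤ) ^ j) 0 ((m : ℤ) ^ j) →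
      IsLevelLattice m (2 * j + 1) ((m : ℤ) ^ j) (h * (m : ℤ) ^ j) ((m : ℤ) ^ (j + 1)) := by
    intro j hj p t
    rw [hj.succ hm (hne j), pow_succ]
    generalize (m : ℤ) ^ j = M
    rw [hh]
    constructor
    · rintro ⟨x, y, rfl, rfl⟩
      exact ⟨(2 * h + 1) * x + 2 * y, -h * x - y, by ring, by ring⟩
    · rintro ⟨x, y, rfl, rfl⟩
      exact ⟨x + 2 * y, -h * x - (2 * h + 1) * y, by ring, by ring⟩
  induction j with
  | zero => exact ⟨by simpa using isLevelLattice_zero, step 0 (by simpa using isLevelLattice_zero)⟩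
  | succ j ih =>
    have key : IsLevelLattice m (2 * (j + 1)) ((m : ℤ) ^ (j + 1)) 0 ((m : ℤ) ^ (j + 1)) := by
      intro p t
      have := ih.2.succ hm (hne j) p t
      rw [show 2 * (j + 1) = 2 * j + 1 + 1 by ring, this, pow_succ]
      generalize (m : ℤ) ^ j = M
      rw [hh]
      constructor
      · rintro ⟨x, y, rfl, rfl⟩
        exact ⟨(2 * h + 1) * x + 2 * y, -h * x - y, by ring, by ring⟩
      · rintro ⟨x, y, rfl, rfl⟩
        exact ⟨x + 2 * y, -h * x - (2 * h + 1) * y, by ring, by ring⟩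
    exact ⟨key, step _ key⟩

/-- From level 1 on, mq + 2mc = 0, so the new generators are already triangular and only trade
places. Level 0 has c = 0 and does not fit this pattern. -/
theorem isLevelLattice_of_even (hm : 2 ≤ m) {h : ℤ} (hh : (m : ℤ) = 2 * h) (j : ℕ) :
    IsLevelLattice m (2 * j + 1) (2 * (m : ℤ) ^ j) (-(m : ℤ) ^ j) (h * (m : ℤ) ^ j) ∧
      IsLevelLattice m (2 * (j + 1)) ((m : ℤ) ^ (j + 1)) (-h * (m : ℤ) ^ j)
        ((m : ℤ) ^ (j + 1)) := by
  have hne : ∀ j : ℕ, (m : ℤ) ^ j ≠ 0 := fun j => pow_ne_zero _ (by omega)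
  have step : ∀ j, IsLevelLattice m (2 * j + 1) (2 * (m : ℤ) ^ j) (-(m : ℤ) ^ j)
        (h * (m : ℤ) ^ j) →
      IsLevelLattice m (2 * (j + 1)) ((m : ℤ) ^ (j + 1)) (-h * (m : ℤ) ^ j)
        ((m : ℤ) ^ (j + 1)) := by
    intro j hj p t
    rw [show 2 * (j + 1) = 2 * j + 1 + 1 by ring,
      hj.succ hm (mul_ne_zero two_ne_zero (hne j)), pow_succ]
    generalize (m : ℤ) ^ j = M
    rw [hh]
    constructor
    · rintro ⟨x, y, rfl, rfl⟩
      exact ⟨y, x, by ring, by ring⟩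
    · rintro ⟨x, y, rfl, rfl⟩
      exact ⟨y, x, by ring, by ring⟩
  induction j with
  | zero =>
    have key : IsLevelLattice m (2 * 0 + 1) (2 * (m : ℤ) ^ 0) (-(m : ℤ) ^ 0)
        (h * (m : ℤ) ^ 0) := by
      intro p t
      rw [show 2 * 0 + 1 = 0 + 1 from rfl, isLevelLattice_zero.succ hm one_ne_zero, hh]
      constructor
      · rintro ⟨x, y, rfl, rfl⟩
        exact ⟨h * x + y, x, by ring, by ring⟩
      · rintro ⟨x, y, rfl, rfl⟩
        exact ⟨y, x - h * y, by ring, by ring⟩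
    exact ⟨key, step _ key⟩
  | succ j ih =>
    have key : IsLevelLattice m (2 * (j + 1) + 1) (2 * (m : ℤ) ^ (j + 1)) (-(m : ℤ) ^ (j + 1))
        (h * (m : ℤ) ^ (j + 1)) := by
      intro p t
      rw [ih.2.succ hm (hne _), pow_succ]
      generalize (m : ℤ) ^ j = M
      rw [hh]
      constructor
      · rintro ⟨x, y, rfl, rfl⟩
        exact ⟨y, x, by ring, by ring⟩
      · rintro ⟨x, y, rfl, rfl⟩
        exact ⟨y, x, by ring, by ring⟩
    exact ⟨key, step _ key⟩

-- The index of D·St_H(n) in H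

/-- The index of `⟨⟨ab⟩⟩ St(n)` in the group `⟨a, b⟩`. -/
def diagIndex (m n : ℕ) : ℕ := m ^ (n / 2) * if Even m ∧ Odd n then 2 else 1

theorem exists_levelRelation_iff (hm : 2 ≤ m) (n : ℕ) (k : ℤ) :
    (∃ l, LevelRelation m n k l) ↔ (diagIndex m n : ℤ) ∣ k := by
  have key : ∀ q c r : ℤ, IsLevelLattice m n q c r →
      ((∃ l, LevelRelation m n k l) ↔ q ∣ k) := by
    intro q c r h
    constructor
    · rintro ⟨l, hl⟩
      obtain ⟨x, -, hx, -⟩ := (h k l).1 hl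
      exact ⟨x, hx⟩
    · rintro ⟨x, hx⟩
      exact ⟨c * x, (h _ _).2 ⟨x, 0, hx, by ring⟩⟩
  unfold diagIndex
  obtain ⟨j, rfl | rfl⟩ := Nat.even_or_odd' n
  · have h1 : ¬ Odd (2 * j) := by simp
    rw [if_neg (fun h => h1 h.2), Nat.mul_div_cancel_left _ two_pos]
    push_cast
    rw [mul_one]
    obtain ⟨h, rfl | rfl⟩ := Nat.even_or_odd' m
    · cases j with
      | zero => simpa using key _ _ _ isLevelLattice_zero
      | succ j => simpa using key _ _ _ (isLevelLattice_of_even hm (h := h) (by push_cast; rfl) j).2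
    · simpa using key _ _ _ (isLevelLattice_of_odd hm (h := h) (by push_cast; rfl) j).1
  · have h1 : (2 * j + 1) / 2 = j := by omega
    rw [h1]
    obtain ⟨h, rfl | rfl⟩ := Nat.even_or_odd' m
    · rw [if_pos ⟨by simp, by simp⟩]
      simpa [mul_comm] using key _ _ _ (isLevelLattice_of_even hm (h := h) (by push_cast; rfl) j).1
    · rw [if_neg (by simp)]
      simpa using key _ _ _ (isLevelLattice_of_odd hm (h := h) (by push_cast; rfl) j).2

instance diagSubgroup_normal : ((diagSubgroup m).subgroupOf (bsvGroup m)).Normal where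
  conj_mem := by
    rintro ⟨n, _⟩ ⟨l, hl⟩ ⟨g, hg⟩
    obtain ⟨s, t, h⟩ := mem_bsvGroup.1 hg
    exact ⟨l, ((h.mul hl).mul h.inv).congr (by ring) (by ring)⟩

/-- An element with exponents (s, t) lies in a^(s − t) D, so ℤ maps onto H / D·St_H(n) through
powers of a. The kernel consists of the first coordinates of the level n lattice. -/
theorem relIndex_bsvGroup_eq (hm : 2 ≤ m) (n : ℕ) :
    (levelStabilizer m n).relIndex (bsvGroup m) =
      (levelStabilizer m n).relIndex (diagSubgroup m) * diagIndex m n := by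
  let S := (levelStabilizer m n).subgroupOf (bsvGroup m)
  let N := (diagSubgroup m).subgroupOf (bsvGroup m)
  have h1 : S.relIndex N = (levelStabilizer m n).relIndex (diagSubgroup m) := by
    have := Subgroup.relIndex_comap (levelStabilizer m n) (bsvGroup m).subtype N
    rwa [Subgroup.map_subgroupOf_eq_of_le diagSubgroup_le] at this
  have h2 : S.relIndex (N ⊔ S) * (N ⊔ S).index = S.index :=
    Subgroup.relIndex_mul_index le_sup_right
  rw [Subgroup.relIndex_sup_right, h1] at h2
  change S.index = _
  rw [← h2]
  congr 1
  let α : bsvGroup m := ⟨genA m, genA_mem⟩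
  let F : Multiplicative ℤ →* bsvGroup m ⧸ (N ⊔ S) := (QuotientGroup.mk' _).comp (zpowersHom _ α)
  have hF : ∀ k : ℤ, F (Multiplicative.ofAdd k) = QuotientGroup.mk' _ (α ^ k) := fun k => by
    simp [F]
  have hsurj : Function.Surjective F := by
    intro y
    obtain ⟨⟨g, hg⟩, rfl⟩ := QuotientGroup.mk'_surjective _ y
    obtain ⟨s, t, h⟩ := mem_bsvGroup.1 hg
    refine ⟨Multiplicative.ofAdd (s - t), ?_⟩
    rw [hF]
    refine QuotientGroup.eq.2 ((le_sup_left : N ≤ N ⊔ S) ?_)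
    refine ⟨t, ?_⟩
    exact ((HasExponents.genA_zpow (s - t)).inv.mul h).congr (by ring) (by ring)
  have hker : F.ker = AddSubgroup.toSubgroup (AddSubgroup.zmultiples (diagIndex m n : ℤ)) := by
    ext k
    obtain ⟨k, rfl⟩ := Multiplicative.ofAdd.surjective k
    have h3 : F (Multiplicative.ofAdd k) = 1 ↔ α ^ k ∈ N ⊔ S := by
      rw [hF]
      exact QuotientGroup.eq_one_iff _
    have h4 : Multiplicative.ofAdd k ∈
        AddSubgroup.toSubgroup (AddSubgroup.zmultiples (diagIndex m n : ℤ)) ↔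
          k ∈ AddSubgroup.zmultiples (diagIndex m n : ℤ) := Iff.rfl
    rw [MonoidHom.mem_ker, h3, h4, Int.mem_zmultiples_iff, ← exists_levelRelation_iff hm,
      Subgroup.mem_sup_of_normal_left]
    constructor
    · rintro ⟨⟨y, _⟩, ⟨l, hl⟩, z, hz, hyz⟩
      have hyz' : y * z = genA m ^ k := congrArg Subtype.val hyz
      have hz' : (z : Gamma m) = y⁻¹ * genA m ^ k := by rw [← hyz', inv_mul_cancel_left]
      refine ⟨-l, z, hz, ?_⟩
      rw [hz']
      exact (HasExponents.inv hl |>.mul (HasExponents.genA_zpow k)).congr (by ring) (by ring)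
    · rintro ⟨l, g, hg, h⟩
      have hy : HasExponents (genA m ^ k * g⁻¹) (-l) (-l) :=
        ((HasExponents.genA_zpow k).mul h.inv).congr (by ring) (by ring)
      refine ⟨⟨_, mem_bsvGroup.2 ⟨_, _, hy⟩⟩, ⟨_, hy⟩, ⟨g, mem_bsvGroup.2 ⟨_, _, h⟩⟩, hg, ?_⟩
      apply Subtype.ext
      change genA m ^ k * g⁻¹ * g = genA m ^ k
      group
  have h5 := Subgroup.index_ker F
  rw [hker, AddSubgroup.index_toSubgroup, Int.index_zmultiples, Int.natAbs_natCast,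
    MonoidHom.range_eq_top.2 hsurj, Nat.card_congr Subgroup.topEquiv.toEquiv] at h5
  exact h5.symm

-- Logarithms of the indices and the limit of their ratio

/-- `log_m |Γ_m : St(n)|`. -/
noncomputable def gammaLog (m n : ℕ) : ℝ := Real.logb m (levelStabilizer m n).index

/-- `log_m |H : St_H(n)|`. -/
noncomputable def bsvLog (m n : ℕ) : ℝ :=
  Real.logb m ((levelStabilizer m n).relIndex (bsvGroup m))

/-- The Hausdorff dimension of the closure of `H`. -/
noncomputable def bsvDim (m : ℕ) : ℝ := (m - tau m * (m - 1) * Real.logb m 2) / (m + 1)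

theorem index_pos (n : ℕ) : 0 < (levelStabilizer m n).index :=
  Nat.pos_of_ne_zero Subgroup.FiniteIndex.index_ne_zero

theorem relIndex_pos (n : ℕ) (G : Subgroup (Gamma m)) : 0 < (levelStabilizer m n).relIndex G :=
  Nat.pos_of_ne_zero Subgroup.FiniteIndex.index_ne_zero

theorem one_lt_cast (hm : 2 ≤ m) : (1 : ℝ) < m := by exact_mod_cast (by omega : 1 < m)

theorem gammaLog_zero : gammaLog m 0 = 0 := by simp [gammaLog, levelStabilizer_zero]

theorem bsvLog_zero : bsvLog m 0 = 0 := by simp [bsvLog, levelStabilizer_zero]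

theorem gammaLog_succ (hm : 2 ≤ m) (n : ℕ) : gammaLog m (n + 1) = 1 + m * gammaLog m n := by
  have h0 := one_lt_cast hm
  have h1 : ((levelStabilizer m n).index : ℝ) ≠ 0 := by exact_mod_cast (index_pos n).ne'
  rw [gammaLog, gammaLog, index_levelStabilizer_succ hm]
  push_cast
  rw [Real.logb_mul (by positivity) (by positivity), Real.logb_self_eq_one h0, Real.logb_pow]

theorem logb_diagIndex (hm : 2 ≤ m) (n : ℕ) :
    Real.logb m (diagIndex m n) =
      ((n / 2 : ℕ) : ℝ) + tau m * if Odd n then Real.logb m 2 else 0 := by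
  have h0 := one_lt_cast hm
  unfold diagIndex tau
  push_cast
  rw [Real.logb_mul (by positivity) (by split_ifs <;> norm_num), Real.logb_pow,
    Real.logb_self_eq_one h0, mul_one]
  congr 1
  by_cases h1 : Even m <;> by_cases h2 : Odd n <;> simp [h1, h2]

theorem bsvLog_succ (hm : 2 ≤ m) (n : ℕ) :
    bsvLog m (n + 1) = 1 + m * bsvLog m n - (m - 1) * Real.logb m (diagIndex m n) := by
  have h0 := one_lt_cast hm
  have h1 : ((levelStabilizer m n).relIndex (bsvGroup m) : ℝ) ≠ 0 := by
    exact_mod_cast (relIndex_pos n _).ne'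
  have h2 : ((levelStabilizer m n).relIndex (diagSubgroup m) : ℝ) ≠ 0 := by
    exact_mod_cast (relIndex_pos n _).ne'
  have h3 : bsvLog m n = Real.logb m ((levelStabilizer m n).relIndex (diagSubgroup m)) +
      Real.logb m (diagIndex m n) := by
    have h4 : (diagIndex m n : ℝ) ≠ 0 := by
      intro h
      rw [relIndex_bsvGroup_eq hm, Nat.cast_mul, h, mul_zero] at h1
      exact h1 rfl
    rw [bsvLog, relIndex_bsvGroup_eq hm, Nat.cast_mul, Real.logb_mul h2 h4]
  have h5 : bsvLog m (n + 1) = 1 + bsvLog m n +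
      (m - 1) * Real.logb m ((levelStabilizer m n).relIndex (diagSubgroup m)) := by
    rw [bsvLog, relIndex_bsvGroup_succ hm]
    push_cast
    rw [Real.logb_mul (by positivity) (by positivity), Real.logb_mul (by positivity) h1,
      Real.logb_self_eq_one h0, Real.logb_pow, Nat.cast_sub (by omega), Nat.cast_one]
    rfl
  rw [h5, h3]
  ring

/-- The recursion multiplies the error by m at each step; `bsvDim m` is the coefficient for which
the remaining terms cancel this growth over two levels, leaving an increase of exactly 1. -/
theorem bsvLog_eq (hm : 2 ≤ m) (j : ℕ) :
    bsvLog m (2 * j) = bsvDim m * gammaLog m (2 * j) + j ∧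
      bsvLog m (2 * j + 1) = bsvDim m * gammaLog m (2 * j + 1) + j + (1 - bsvDim m) := by
  have hdim : bsvDim m * (m + 1) = m - tau m * (m - 1) * Real.logb m 2 :=
    div_mul_cancel₀ _ (by positivity)
  have step : ∀ j : ℕ, bsvLog m (2 * j) = bsvDim m * gammaLog m (2 * j) + j →
      bsvLog m (2 * j + 1) = bsvDim m * gammaLog m (2 * j + 1) + j + (1 - bsvDim m) := by
    intro j hj
    have h1 : ¬ Odd (2 * j) := by simp
    have h2 : 2 * j / 2 = j := by omega
    rw [bsvLog_succ hm, logb_diagIndex hm, if_neg h1, h2, hj, gammaLog_succ hm]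
    ring
  induction j with
  | zero => exact ⟨by simp [bsvLog_zero, gammaLog_zero], step 0 (by simp [bsvLog_zero, gammaLog_zero])⟩
  | succ j ih =>
    have key : bsvLog m (2 * (j + 1)) = bsvDim m * gammaLog m (2 * (j + 1)) + (j + 1 : ℕ) := by
      have h1 : Odd (2 * j + 1) := by simp
      have h2 : (2 * j + 1) / 2 = j := by omega
      rw [show 2 * (j + 1) = 2 * j + 1 + 1 by ring, bsvLog_succ hm, logb_diagIndex hm, if_pos h1,
        h2, ih.2, gammaLog_succ hm (2 * j + 1)]
      push_cast
      linear_combination -hdim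
    exact ⟨key, step _ key⟩

theorem tau_nonneg : 0 ≤ tau m := by unfold tau; split_ifs <;> norm_num

theorem tau_le_one : tau m ≤ 1 := by unfold tau; split_ifs <;> norm_num

theorem logb_two_nonneg (hm : 2 ≤ m) : 0 ≤ Real.logb m 2 :=
  Real.logb_nonneg (one_lt_cast hm) (by norm_num)

theorem logb_two_le_one (hm : 2 ≤ m) : Real.logb m 2 ≤ 1 := by
  rw [← Real.logb_self_eq_one (one_lt_cast hm)]
  exact Real.logb_le_logb_of_le (one_lt_cast hm) (by norm_num) (by exact_mod_cast hm)

theorem bsvDim_pos (hm : 2 ≤ m) : 0 < bsvDim m := by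
  have h0 := one_lt_cast hm
  have h1 : tau m * Real.logb m 2 ≤ 1 :=
    mul_le_one₀ tau_le_one (logb_two_nonneg hm) (logb_two_le_one hm)
  refine div_pos ?_ (by positivity)
  nlinarith

theorem bsvDim_le_one (hm : 2 ≤ m) : bsvDim m ≤ 1 := by
  have h0 := one_lt_cast hm
  have h1 : 0 ≤ tau m * (m - 1) * Real.logb m 2 :=
    mul_nonneg (mul_nonneg tau_nonneg (by linarith)) (logb_two_nonneg hm)
  exact (div_le_one (by positivity)).2 (by linarith)

theorem bsvLog_bounds (hm : 2 ≤ m) (n : ℕ) :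
    bsvDim m * gammaLog m n ≤ bsvLog m n ∧ bsvLog m n ≤ bsvDim m * gammaLog m n + n := by
  have h0 := bsvDim_pos hm
  have h1 := bsvDim_le_one hm
  obtain ⟨j, rfl | rfl⟩ := Nat.even_or_odd' n
  · rw [(bsvLog_eq hm j).1]
    have : (0 : ℝ) ≤ j := by positivity
    push_cast
    constructor <;> linarith
  · rw [(bsvLog_eq hm j).2]
    have : (0 : ℝ) ≤ j := by positivity
    push_cast
    constructor <;> linarith

/-- A crude bound: the growth is exponential, but any superlinear rate absorbs the error n. -/
theorem sq_le_gammaLog (hm : 2 ≤ m) (n : ℕ) : (n : ℝ) ^ 2 ≤ 4 * gammaLog m n := by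
  induction n with
  | zero => simp [gammaLog_zero]
  | succ n ih =>
    have h0 : (2 : ℝ) ≤ m := by exact_mod_cast hm
    rw [gammaLog_succ hm]
    push_cast
    nlinarith [sq_nonneg ((n : ℝ) - 1), sq_nonneg (n : ℝ)]

theorem tendsto_logIndexRatio (hm : 2 ≤ m) :
    Tendsto (logIndexRatio (bsvGroup m)) atTop (𝓝 (bsvDim m)) := by
  have hlim : Tendsto (fun n : ℕ => bsvDim m + 4 / (n : ℝ)) atTop (𝓝 (bsvDim m)) := by
    simpa using (tendsto_const_div_atTop_nhds_zero_nat (4 : ℝ)).const_add (bsvDim m)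
  refine tendsto_of_tendsto_of_tendsto_of_le_of_le' tendsto_const_nhds hlim ?_ ?_
  · filter_upwards [eventually_gt_atTop 0] with n hn
    have h1 := sq_le_gammaLog hm n
    have h2 : (0 : ℝ) < n := by exact_mod_cast hn
    have h3 : 0 < gammaLog m n := by nlinarith
    exact (le_div_iff₀ h3).2 (bsvLog_bounds hm n).1
  · filter_upwards [eventually_gt_atTop 0] with n hn
    have h1 := sq_le_gammaLog hm n
    have h2 : (0 : ℝ) < n := by exact_mod_cast hn
    have h3 : 0 < gammaLog m n := by nlinarith
    refine (div_le_iff₀ h3).2 ((bsvLog_bounds hm n).2.trans ?_)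
    rw [add_mul, add_le_add_iff_left, div_mul_eq_mul_div, le_div_iff₀ h2]
    linarith

-- The metric: balls, invariance, compactness

theorem index_strictMono (hm : 2 ≤ m) : StrictMono fun n => (levelStabilizer m n).index := by
  refine strictMono_nat_of_lt_succ fun n => ?_
  have h1 := index_pos (m := m) n
  rw [index_levelStabilizer_succ hm]
  have h2 : (levelStabilizer m n).index ≤ (levelStabilizer m n).index ^ m :=
    Nat.le_self_pow (by omega) _
  nlinarith

theorem edist_le_of_mem {g h : Gamma m} {n : ℕ} (H : g * h⁻¹ ∈ levelStabilizer m n) :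
    edist g h ≤ ((levelStabilizer m n).index : ℝ≥0∞)⁻¹ := by
  change gammaEDist g h ≤ _
  unfold gammaEDist
  split_ifs with hgh
  · exact zero_le
  · exact iInf₂_le n H

theorem le_edist_of_notMem {g h : Gamma m} {n : ℕ} (H : g * h⁻¹ ∉ levelStabilizer m (n + 1)) :
    ((levelStabilizer m n).index : ℝ≥0∞)⁻¹ ≤ edist g h := by
  change _ ≤ gammaEDist g h
  unfold gammaEDist
  split_ifs with hgh
  · exact absurd (by simp [hgh, one_mem]) H
  · refine le_iInf₂ fun k hk => ENNReal.inv_le_inv.2 (Nat.cast_le.2 ?_)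
    refine Subgroup.index_antitone (levelStabilizer_antitone m ?_)
    by_contra! hlt
    exact H (levelStabilizer_antitone m hlt hk)

theorem mem_of_edist_le (hm : 2 ≤ m) {g h : Gamma m} {n : ℕ}
    (H : edist g h ≤ ((levelStabilizer m n).index : ℝ≥0∞)⁻¹) :
    g * h⁻¹ ∈ levelStabilizer m n := by
  cases n with
  | zero => simp [levelStabilizer_zero]
  | succ n =>
    by_contra hn
    have h1 := ENNReal.inv_le_inv.1 ((le_edist_of_notMem hn).trans H)
    exact absurd (Nat.cast_le.1 h1) (not_le.2 (index_strictMono hm n.lt_succ_self))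

theorem tendsto_inv_index (hm : 2 ≤ m) :
    Tendsto (fun n => ((levelStabilizer m n).index : ℝ≥0∞)⁻¹) atTop (𝓝 0) :=
  ENNReal.tendsto_inv_nat_nhds_zero.comp (index_strictMono hm).tendsto_atTop

theorem edist_mul_right_eq (g h k : Gamma m) : edist (g * k) (h * k) = edist g h := by
  rcases eq_or_ne g h with rfl | hgh
  · rw [edist_self, edist_self]
  · change gammaEDist _ _ = gammaEDist _ _
    rw [gammaEDist, gammaEDist, if_neg hgh, if_neg (mt mul_right_cancel hgh)]
    simp [mul_assoc]

theorem edist_mul_left_eq (g h k : Gamma m) : edist (k * g) (k * h) = edist g h := by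
  have h1 : ∀ n, k * g * (k * h)⁻¹ ∈ levelStabilizer m n ↔ g * h⁻¹ ∈ levelStabilizer m n := by
    intro n
    rw [Subgroup.Normal.mem_comm_iff inferInstance]
    simp [mul_assoc, Subgroup.Normal.mem_comm_iff (inferInstance : (levelStabilizer m n).Normal)]
  rcases eq_or_ne g h with rfl | hgh
  · rw [edist_self, edist_self]
  · change gammaEDist _ _ = gammaEDist _ _
    rw [gammaEDist, gammaEDist, if_neg hgh, if_neg (mt mul_left_cancel hgh)]
    simp only [h1]

theorem edist_inv_inv_eq (g h : Gamma m) : edist g⁻¹ h⁻¹ = edist g h := by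
  rw [← edist_mul_left_eq _ _ g, ← edist_mul_right_eq _ _ h, edist_comm g h]
  simp

instance : IsTopologicalGroup (Gamma m) where
  continuous_mul := by
    refine LipschitzWith.continuous (K := 2) fun p q => ?_
    calc edist (p.1 * p.2) (q.1 * q.2)
        ≤ edist (p.1 * p.2) (q.1 * p.2) + edist (q.1 * p.2) (q.1 * q.2) := edist_triangle _ _ _
      _ = edist p.1 q.1 + edist p.2 q.2 := by rw [edist_mul_right_eq, edist_mul_left_eq]
      _ ≤ edist p q + edist p q := add_le_add (le_max_left _ _) (le_max_right _ _)
      _ = _ := by rw [← two_mul]; rfl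
  continuous_inv := (Isometry.continuous fun g h => edist_inv_inv_eq g h)

theorem finite_level (n : ℕ) : {v : List (Fin m) | v.length = n}.Finite := by
  have : Finite {v : List (Fin m) // v.length = n} :=
    inferInstanceAs (Finite (List.Vector (Fin m) n))
  exact Set.finite_coe_iff.1 this

/-- Levels are finite, so along an ultrafilter the image of each vertex is eventually constant.
Taking limits of the inverses as well makes the limit map a bijection. -/
theorem compactSpace_gamma (hm : 2 ≤ m) : CompactSpace (Gamma m) := by
  refine ⟨isCompact_iff_ultrafilter_le_nhds.2 fun F _ => ?_⟩
  have hlim : ∀ φ : Gamma m → Gamma m, ∀ v : List (Fin m), ∃ w, ∀ᶠ g in F, act (φ g) v = w := by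
    intro φ v
    have := (Ultrafilter.eventually_exists_mem_iff (f := F)
      (P := fun w g => act (φ g) v = w) (finite_level (m := m) v.length)).1
      (Eventually.of_forall fun g => ⟨_, act_length (φ g) v, rfl⟩)
    obtain ⟨w, -, hw⟩ := this
    exact ⟨w, hw⟩
  choose f hf using hlim fun g => g
  choose f' hf' using hlim fun g => g⁻¹
  have hleft : ∀ v, f' (f v) = v := fun v => by
    obtain ⟨g, h1, h2⟩ := ((hf v).and (hf' (f v))).exists
    rw [← h2, ← h1, act_inv_act]
  have hright : ∀ v, f (f' v) = v := fun v => by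
    obtain ⟨g, h1, h2⟩ := ((hf' v).and (hf (f' v))).exists
    rw [← h2, ← h1, act_act_inv]
  have hcyc : HasCyclicLabels f := fun v => by
    obtain ⟨g, h1, h2⟩ := ((hf v).and (eventually_all.2 fun x : Fin m => hf (v ++ [x]))).exists
    obtain ⟨k, hk⟩ := act_append_singleton g v
    exact ⟨k, fun x => by rw [← h2, ← h1, hk]⟩
  let g₀ : Gamma m := Gamma.ofPerm ⟨f, f', hleft, hright⟩ hcyc
  have hg₀ : ∀ v, act g₀ v = f v := fun v => rfl
  refine ⟨g₀, trivial, Metric.nhds_basis_eball.ge_iff.2 fun ε hε => ?_⟩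
  obtain ⟨n, hn⟩ := ((tendsto_inv_index hm).eventually_lt_const hε).exists
  have hev : ∀ᶠ g in (F : Filter (Gamma m)), ∀ v ∈ {v : List (Fin m) | v.length = n}, act g v = f v :=
    (eventually_all_finite (finite_level n)).2 fun v _ => hf v
  filter_upwards [hev] with g hg
  refine (edist_le_of_mem (n := n) ?_).trans_lt hn
  rw [Subgroup.Normal.mem_comm_iff inferInstance]
  intro v hv
  rw [act_mul, hg v hv, ← hg₀, act_inv_act]

-- Hausdorff dimension of the closure

theorem index_eq_rpow (hm : 2 ≤ m) (n : ℕ) :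
    ((levelStabilizer m n).index : ℝ≥0∞)⁻¹ = (m : ℝ≥0∞) ^ (-gammaLog m n) := by
  have h0 := one_lt_cast hm
  have h1 : (0 : ℝ) < (levelStabilizer m n).index := by exact_mod_cast index_pos n
  have h2 := Real.rpow_logb (by linarith) h0.ne' h1
  rw [ENNReal.rpow_neg, inv_inj, ← ENNReal.ofReal_natCast m,
    ENNReal.ofReal_rpow_of_pos (by linarith)]
  rw [gammaLog, h2, ENNReal.ofReal_natCast]

theorem relIndex_eq_rpow (hm : 2 ≤ m) (n : ℕ) :
    ((levelStabilizer m n).relIndex (bsvGroup m) : ℝ≥0∞) = (m : ℝ≥0∞) ^ bsvLog m n := by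
  have h0 := one_lt_cast hm
  have h1 : (0 : ℝ) < (levelStabilizer m n).relIndex (bsvGroup m) := by
    exact_mod_cast relIndex_pos n _
  have h2 := Real.rpow_logb (by linarith) h0.ne' h1
  rw [← ENNReal.ofReal_natCast m, ENNReal.ofReal_rpow_of_pos (by linarith)]
  rw [bsvLog, h2, ENNReal.ofReal_natCast]

theorem one_le_cast_ennreal (hm : 2 ≤ m) : (1 : ℝ≥0∞) ≤ m := by
  exact_mod_cast (by omega : 1 ≤ m)

open MeasureTheory in
theorem dimH_closure_bsvGroup_le (hm : 2 ≤ m) :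
    dimH (closure (bsvGroup m : Set (Gamma m))) ≤ ENNReal.ofReal (bsvDim m) := by
  refine ENNReal.le_of_forall_pos_le_add fun ε hε _ => ?_
  have hd : ENNReal.ofReal (bsvDim m) + ε = ((bsvDim m).toNNReal + ε : NNReal) := by
    simp [ENNReal.ofReal]
  rw [hd]
  borelize ↥(Gamma m)
  refine dimH_le_of_hausdorffMeasure_ne_top (ne_top_of_le_ne_top ENNReal.one_ne_top ?_)
  let ι : ℕ → Type := fun n => bsvGroup m ⧸ (levelStabilizer m n).subgroupOf (bsvGroup m)
  let ιfin : ∀ n, Fintype (ι n) := fun n => Fintype.ofFinite _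
  let t : ∀ n, ι n → Set (Gamma m) := fun n q =>
    Metric.closedEBall (q.out : Gamma m) ((levelStabilizer m n).index : ℝ≥0∞)⁻¹
  have hdiam : ∀ n (q : ι n), Metric.ediam (t n q) ≤ ((levelStabilizer m n).index : ℝ≥0∞)⁻¹ := by
    intro n q
    refine Metric.ediam_le fun x hx y hy => edist_le_of_mem ?_
    have := mul_mem (mem_of_edist_le hm hx) (inv_mem (mem_of_edist_le hm hy))
    simpa [mul_assoc] using this
  have hcover : ∀ n, closure (bsvGroup m : Set (Gamma m)) ⊆ ⋃ q, t n q := by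
    intro n
    refine closure_minimal (fun g hg => ?_)
      (isClosed_iUnion_of_finite fun q => Metric.isClosed_closedEBall)
    refine Set.mem_iUnion.2 ⟨QuotientGroup.mk ⟨g, hg⟩, edist_le_of_mem ?_⟩
    rw [Subgroup.Normal.mem_comm_iff inferInstance]
    have hq : (QuotientGroup.mk ⟨g, hg⟩ : ι n).out⁻¹ * ⟨g, hg⟩ ∈
        (levelStabilizer m n).subgroupOf (bsvGroup m) :=
      QuotientGroup.eq.1 (QuotientGroup.out_eq' _)
    exact hq
  refine (Measure.hausdorffMeasure_le_liminf_sum _ _ _ (tendsto_inv_index hm) t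
    (Eventually.of_forall hdiam) (Eventually.of_forall hcover)).trans ?_
  refine liminf_le_of_frequently_le' (Eventually.frequently ?_)
  -- For n > 4/ε the quadratic bound gives n ≤ ε · `gammaLog m n`, so the extra ε in the exponent
  -- pays for the error term.
  obtain ⟨N, hN⟩ := exists_nat_gt (4 / (ε : ℝ))
  filter_upwards [eventually_ge_atTop N] with n hn
  have hd0 : (0 : ℝ) ≤ ((bsvDim m).toNNReal + ε : NNReal) := NNReal.coe_nonneg _
  have hmne : (m : ℝ≥0∞) ≠ 0 := (zero_lt_one.trans_le (one_le_cast_ennreal hm)).ne'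
  calc ∑ q, Metric.ediam (t n q) ^ (((bsvDim m).toNNReal + ε : NNReal) : ℝ)
      ≤ ∑ _q : ι n, ((m : ℝ≥0∞) ^ (-gammaLog m n)) ^ (((bsvDim m).toNNReal + ε : NNReal) : ℝ) := by
        refine Finset.sum_le_sum fun q _ => ENNReal.rpow_le_rpow ?_ hd0
        rw [← index_eq_rpow hm]
        exact hdiam n q
    _ = (m : ℝ≥0∞) ^ (bsvLog m n + -gammaLog m n * ((bsvDim m).toNNReal + ε : NNReal)) := by
        rw [Finset.sum_const, nsmul_eq_mul, Finset.card_univ, ← Nat.card_eq_fintype_card,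
          ← ENNReal.rpow_mul, ENNReal.rpow_add _ _ hmne (ENNReal.natCast_ne_top m),
          ← relIndex_eq_rpow hm]
        rfl
    _ ≤ (m : ℝ≥0∞) ^ (0 : ℝ) := by
        refine ENNReal.rpow_le_rpow_of_exponent_le (one_le_cast_ennreal hm) ?_
        rw [NNReal.coe_add, Real.coe_toNNReal _ (bsvDim_pos hm).le]
        have h1 := (bsvLog_bounds hm n).2
        have h2 := sq_le_gammaLog hm n
        have hε' : (0 : ℝ) < ε := by exact_mod_cast hε
        have h3 : 4 < n * (ε : ℝ) := by
          rw [← div_lt_iff₀ hε']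
          exact hN.trans_le (by exact_mod_cast hn)
        have h4 : (n : ℝ) * 4 ≤ n * (n * ε) :=
          mul_le_mul_of_nonneg_left h3.le (Nat.cast_nonneg n)
        have h5 : (n : ℝ) ^ 2 * ε ≤ 4 * gammaLog m n * ε :=
          mul_le_mul_of_nonneg_right h2 hε'.le
        nlinarith
    _ = 1 := ENNReal.rpow_zero

open MeasureTheory in
theorem le_dimH_closure_bsvGroup (hm : 2 ≤ m) :
    ENNReal.ofReal (bsvDim m) ≤ dimH (closure (bsvGroup m : Set (Gamma m))) := by
  have := compactSpace_gamma hm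
  let K := (bsvGroup m).topologicalClosure
  have hK : IsClosed (K : Set (Gamma m)) := (bsvGroup m).isClosed_topologicalClosure
  have : CompactSpace K := isCompact_iff_compactSpace.1 hK.isCompact
  have hdim : dimH (closure (bsvGroup m : Set (Gamma m))) = dimH (Set.univ : Set K) := by
    have himage : ((↑) : K → Gamma m) '' Set.univ = closure (bsvGroup m : Set (Gamma m)) := by
      rw [Set.image_univ, Subtype.range_coe]
      rfl
    rw [← himage]
    exact Isometry.dimH_image isometry_subtype_coe _
  rw [hdim]
  borelize ↥K
  let μ : Measure K := Measure.haarMeasure ⊤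
  have hμ : μ Set.univ = 1 := Measure.haarMeasure_self (K₀ := (⊤ : TopologicalSpace.PositiveCompacts K))
  have hd : 0 < bsvDim m := bsvDim_pos hm
  have hstab : ∀ n, μ ((levelStabilizer m n).subgroupOf K : Set K) ≤
      (m : ℝ≥0∞) ^ (-bsvLog m n) := by
    intro n
    have hclosed : IsClosed ((levelStabilizer m n).subgroupOf K : Set K) := by
      have h1 : ((levelStabilizer m n).subgroupOf K : Set K) =
          Metric.closedEBall (1 : K) ((levelStabilizer m n).index : ℝ≥0∞)⁻¹ := by
        ext x
        have h2 : (x : Gamma m) * ((1 : K) : Gamma m)⁻¹ = x := by simp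
        constructor
        · intro hx
          exact edist_le_of_mem (by rw [h2]; exact hx)
        · intro hx
          have := mem_of_edist_le hm (h := ((1 : K) : Gamma m)) (g := (x : Gamma m)) hx
          rw [h2] at this
          exact this
      rw [h1]
      exact Metric.isClosed_closedEBall
    have h1 := Subgroup.index_mul_measure ((levelStabilizer m n).subgroupOf K)
      hclosed.measurableSet μ
    rw [hμ] at h1
    -- The closure has the same indices as H, but this inequality suffices to bound the Haar measure
    -- from above.
    have h2 : (levelStabilizer m n).relIndex (bsvGroup m) ≤ (levelStabilizer m n).relIndex K :=
      Subgroup.relIndex_le_of_le_right (bsvGroup m).le_topologicalClosure (relIndex_pos n K).ne'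
    rw [ENNReal.rpow_neg, ← relIndex_eq_rpow hm]
    rw [ENNReal.eq_inv_of_mul_eq_one_left ((mul_comm _ _).trans h1)]
    exact ENNReal.inv_le_inv.2 (Nat.cast_le.2 h2)
  have hcoset : ∀ (n : ℕ) (s : Set K) (x : K), (∀ y ∈ s, (y * x⁻¹ : Gamma m) ∈ levelStabilizer m n) →
      μ s ≤ (m : ℝ≥0∞) ^ (-bsvLog m n) := by
    intro n s x hs
    refine le_trans ?_ (hstab n)
    rw [← measure_preimage_mul μ x]
    refine measure_mono fun y hy => ?_
    have h1 := (Subgroup.Normal.mem_comm_iff inferInstance).1 (hs _ hy)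
    rwa [Subgroup.coe_mul, Subgroup.coe_inv, inv_mul_cancel_left] at h1
  -- Mass distribution: μ(s) ≤ diam(s)^d with constant 1, because the lower bound on `bsvLog`
  -- carries no error term.
  have key : μ ≤ Measure.hausdorffMeasure (bsvDim m) := by
    refine Measure.le_hausdorffMeasure _ _ 1 one_pos fun s _ => ?_
    have hbound : ∀ n, (m : ℝ≥0∞) ^ (-bsvLog m n) ≤
        (((levelStabilizer m n).index : ℝ≥0∞)⁻¹) ^ bsvDim m := by
      intro n
      rw [index_eq_rpow hm, ← ENNReal.rpow_mul]
      refine ENNReal.rpow_le_rpow_of_exponent_le (one_le_cast_ennreal hm) ?_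
      have := (bsvLog_bounds hm n).1
      linarith
    rcases s.eq_empty_or_nonempty with rfl | ⟨x, hx⟩
    · simp
    by_cases hall : ∀ n, ∀ y ∈ s, (y * x⁻¹ : Gamma m) ∈ levelStabilizer m n
    · have hzero : μ s ≤ 0 := by
        have h1 : Tendsto (fun n => (((levelStabilizer m n).index : ℝ≥0∞)⁻¹) ^ bsvDim m)
            atTop (𝓝 0) := by
          have := ((ENNReal.continuous_rpow_const (y := bsvDim m)).tendsto 0).comp
            (tendsto_inv_index hm)
          rwa [ENNReal.zero_rpow_of_pos hd] at this
        exact ge_of_tendsto' h1 fun n => (hcoset n s x (hall n)).trans (hbound n)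
      exact hzero.trans zero_le
    · have hex : ∃ n, ¬ ∀ y ∈ s, (y * x⁻¹ : Gamma m) ∈ levelStabilizer m n := by
        by_contra! h
        exact hall h
      classical
      -- At the last level n where s stays in one coset of St(n), the measure is bounded through
      -- that coset, while leaving it at level n + 1 forces the diameter to be at least |Γ_m :
      -- St(n)|⁻¹.
      obtain ⟨n, hn⟩ : ∃ n, Nat.find hex = n + 1 := by
        refine Nat.exists_eq_succ_of_ne_zero fun h0 => ?_
        have := Nat.find_spec hex
        rw [h0] at this
        exact this fun y _ => by simp [levelStabilizer_zero]
      have h1 := Nat.find_spec hex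
      have h2 := Nat.find_min hex (m := n) (by omega)
      rw [hn] at h1
      push Not at h1 h2
      obtain ⟨y, hy, hyx⟩ := h1
      refine (hcoset n s x h2).trans ((hbound n).trans (ENNReal.rpow_le_rpow ?_ hd.le))
      exact (le_edist_of_notMem hyx).trans (Metric.edist_le_ediam_of_mem hy hx)
  refine le_dimH_of_hausdorffMeasure_ne_zero (d := (bsvDim m).toNNReal) ?_
  rw [Real.coe_toNNReal _ hd.le]
  have h1 := key Set.univ
  rw [hμ] at h1
  exact (zero_lt_one.trans_le h1).ne'

end MAdicTree

theorem theorem1 (m : ℕ) (hm : 2 ≤ m) :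
    dimH (closure (MAdicTree.bsvGroup m : Set (MAdicTree.Gamma m))) =
        ENNReal.ofReal ((m - MAdicTree.tau m * (m - 1) * Real.logb m 2) / (m + 1)) ∧
      Filter.liminf (fun n => MAdicTree.logIndexRatio (MAdicTree.bsvGroup m) n) Filter.atTop =
        (m - MAdicTree.tau m * (m - 1) * Real.logb m 2) / (m + 1) :=
  ⟨le_antisymm (MAdicTree.dimH_closure_bsvGroup_le hm) (MAdicTree.le_dimH_closure_bsvGroup hm),
    (MAdicTree.tendsto_logIndexRatio hm).liminf_eq⟩
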